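/- Let $J$ be a finite set of customer classes and $X=\bigcup_{k\ge 0}J^k$ the countable set of finite words (queues) over $J$, with empty word $\varnothing$. For $x=(x_1,\dots,x_k)\in X$ write $|x|=k$, $x\oplus j=(x_1,\dots,x_k,j)$, and $x\ominus_r$ for the word $x$ with its $r$-th letter removed. Let a network be given by - a routing matrix $P=(p_{ij})_{i,j\in J}$ with $p_{ij}\ge 0$, $\sum_{j}p_{ij}\le 1$ and spectral radius $\rho(P)<1$; - service rates $\gamma(x,r)\ge 0$, $x\in X$, $1\le r\le |x|$, such that for some $0<\gamma_-\le\gamma_+<\infty$ one has $\gamma_-\le\sum_{r=1}^{|x|}\gamma(x,r)\le\gamma_+$ for all $x\ne\varnothing$. For measurable external arrival rates $\lambda_j(t)\geq 0$, $j\in J$, $t\ge 0$, let the probability measures $\mu_t$, $t\ge 0$, on $X$ be the states of the corresponding non-linear Markov process, i.e. a solution of the countable system of differential equations (in integrated form, coordinate by coordinate) \[ \dot\mu_t=\sum_{x\in X}\mu_t(x)\Big[\sum_{r=1}^{|x|}\gamma(x,r)(\delta_{x\ominus_r}-\delta_x)+\sum_{j\in J}v_j(t)(\delta_{x\oplus j}-\delta_x)\Big],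 \] where \[ v_j(t)=\lambda_j(t)+\sum_{i\in J}p_{ij}u_i(t),\qquad u_i(t)=\sum_{x\in X}\mu_t(x)\sum_{r:\,x_r=i}\gamma(x,r). \] Put $\alpha(\mu)=1-\mu(\varnothing)$ (the fraction of non-empty queues), and say that $\mu_0$ has finite weight if $\sum_{x}|x|\,\mu_0(x)<\infty$. Then there is a constant $\bar C>0$, depending only on the network $(J,P,\gamma)$, such that for every $\varepsilon>0$ and every finite-weight probability measure $\mu_0$ on $X$ there is a time $T=T(\mu_0)\ge 0$ (which may depend on $\varepsilon$) with the following property: for all external arrival rates with $0\le\lambda_j(t)\le\varepsilon$ for all $j\in J$, $t\ge 0$, and every solution $(\mu_t)_{t\ge 0}$ of the above system with initial measure $\mu_0$, \[ \alpha(\mu_t)<\bar C\,\varepsilon\qquad\text{for all } t>T. \] -/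

import Mathlib

open scoped BigOperators

namespace MeanField

/-- A basic open queueing network with a finite set `J` of customer classes. The states are the
words `x : List J`, the oldest customer first; `rate x r` is the rate at which the customer at
position `r` of `x` is served. The `rate` function depends on the word only, and is otherwise an
arbitrary service discipline. -/
structure Network (J : Type*) [Fintype J] [DecidableEq J] where
  /-- `routing i j` is the probability that a served customer of class `i` becomes one of class `j`;
  with the complementary probability the customer leaves the network. -/
  routing : Matrix J J ℝ
  routing_nonneg : ∀ i j, 0 ≤ routing i j
  routing_sum_le_one : ∀ i, ∑ j, routing i j ≤ 1
  /-- The network is open. -/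
  spectralRadius_lt_one : spectralRadius ℂ (routing.map (fun a : ℝ => (a : ℂ))) < 1
  rate : (x : List J) → Fin x.length → ℝ
  rate_nonneg : ∀ x r, 0 ≤ rate x r
  /-- The total service rate at nonempty states is bounded away from zero and from infinity. -/
  rate_bounds : ∃ γm γp : ℝ, 0 < γm ∧ γm ≤ γp ∧
    ∀ x : List J, x ≠ [] → γm ≤ ∑ r, rate x r ∧ ∑ r, rate x r ≤ γp

/-- The space of probability measures on the countable set of words over `J`. -/
def probMeasures (J : Type*) : Set (List J → ℝ) :=
  {μ | (∀ x, 0 ≤ μ x) ∧ HasSum μ 1}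

/-- Finite expected length of the queue. -/
def FiniteWeight {J : Type*} (μ : List J → ℝ) : Prop :=
  Summable fun x : List J => (x.length : ℝ) * μ x

/-- The fraction of nonempty queues. -/
def nonemptyFraction {J : Type*} (μ : List J → ℝ) : ℝ :=
  1 - μ []

noncomputable section

variable {J : Type*} [Fintype J] [DecidableEq J]

/-- The outflow rate of class `j` customers in the state `μ`. -/
def Network.outflow (G : Network J) (μ : List J → ℝ) (j : J) : ℝ :=
  ∑' x : List J, μ x * ∑ r : Fin x.length, if x.get r = j then G.rate x r else 0

/-- The total inflow rate of class `j` customers in the state `μ`, when the external inflow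
rates are `a`: external plus internal inflow. -/
def Network.inflow (G : Network J) (a : J → ℝ) (μ : List J → ℝ) (j : J) : ℝ :=
  a j + ∑ i, G.routing i j * G.outflow μ i

/-- The unit mass at `x`. -/
def pointMass (x : List J) (y : List J) : ℝ :=
  if y = x then 1 else 0

/-- The coordinate at `y` of the right-hand side of the evolution equations, in the state `μ` with
external inflow rates `a`. A service at position `r` erases that letter of the word; an arrival of
class `j` appends the letter `j`. -/
def Network.drift (G : Network J) (a : J → ℝ) (μ : List J → ℝ) (y : List J) : ℝ :=
  ∑' x : List J, μ x *
    ((∑ r : Fin x.length, G.rate x r * (pointMass (x.eraseIdx r) y - pointMass x y)) +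
      ∑ j, G.inflow a μ j * (pointMass (x ++ [j]) y - pointMass x y))

/-- `lam j t` are admissible external arrival rates bounded by `ε`. -/
structure IsExternalInflow (lam : J → ℝ → ℝ) (ε : ℝ) : Prop where
  measurable : ∀ j, Measurable (lam j)
  nonneg : ∀ j t, 0 ≤ t → 0 ≤ lam j t
  le : ∀ j t, 0 ≤ t → lam j t ≤ ε

/-- `μ t`, `t ≥ 0`, is the family of states of the nonlinear Markov process with external arrival
rates `lam`: probability measures that satisfy the countable system of differential equations
`d/dt (μ t y) = G.drift (lam · t) (μ t) y`. The system is taken in integrated form, since the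
arrival rates may be discontinuous in time. -/
structure Network.IsNLMP (G : Network J) (lam : J → ℝ → ℝ) (μ : ℝ → List J → ℝ) : Prop where
  mem_probMeasures : ∀ t, 0 ≤ t → μ t ∈ probMeasures J
  intervalIntegrable : ∀ (y : List J) (t : ℝ), 0 ≤ t →
    IntervalIntegrable (fun s => G.drift (fun j => lam j s) (μ s) y) MeasureTheory.volume 0 t
  eq_integral : ∀ (y : List J) (t : ℝ), 0 ≤ t →
    μ t y = μ 0 y + ∫ s in (0 : ℝ)..t, G.drift (fun j => lam j s) (μ s) y

end

end MeanField

/-!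
The proof compares the network with a single-server queue and uses one Lyapunov function.

Let `V(t)` be the total arrival rate at a queue, `U(t)` the mean total service rate, and `2a` the
lower bound for the service rate of a nonempty queue. By the routing inequality, `V ≤ |J| ε + U`.

*Weight.* As the network is open, a partial sum of the Neumann series of the routing matrix gives
weights `h ≥ 1` with `1 + P h ≤ h` (`Network.exists_weight`). Hence the mean weight `M(t)` of the
queue satisfies `M' ≤ ε ∑ h - U` (`mean_weight_le`). In particular the mean number of arrivals
`∫ V` up to time `t` is at most `M(0) + O(ε) t`.

*Length.* Given `V`, the length of a queue is dominated by that of a single-server queue with arrival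
rate `V` and service rate `2a`. Such a queue is at most as long as the larger of two: one that
starts empty, and a free walk that starts at the given length. For the first one, the mean of
`2 ^ L` is at most the solution `R` of `R' = -a (R - 1) + V R`, `R(0) = 1` (`envelope`). The mean of
the positive part of the second one is at most the initial mean of
`min (2 ^ L * exp (∫ V - a t)) (L + ∫ V)`, which tends to `0` since `∫ V` grows more slowly
than `a t` for small `ε`, the only case that matters, and since the initial mean length is finite
(`tendsto_mean_min_zero`). The resulting bound
`mean_length_le_envelope` is proved without a construction of paths, by a minimum of
supersolutions of the backward equation (`lengthBound`).

*Lyapunov function.* Since `(log R)' = V - a (1 - 1 / R)`, the terms with `U` cancel in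
`Λ = log R + M`, so that `Λ' ≤ O(ε) - a (1 - 1 / R)` (`lyapunov_le`), however large `V` is at times.
So `Λ` decreases at least at the rate of order `ε` while `R - 1` exceeds a multiple of `ε`. When it
does not, `Λ ≤ (R - 1) + M = O(ε)`, because `M` is at most a constant times the mean length, hence
times `R - 1 + ε`. Therefore `Λ = O(ε)` from some time on, and `Λ` bounds the fraction of nonempty
queues.
-/

namespace MeanField

/-! ### Means, and duality between the evolution equations and the generator -/

noncomputable section

variable {J : Type*}

/-- The mean `∑ μ(x) F(x)` of a function of the queue. -/
def mean (μ F : List J → ℝ) : ℝ := ∑' x, μ x * F x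

section Mean

variable {μ : List J → ℝ} {F F' : List J → ℝ} {N : ℝ}

lemma summable_mul_of_bounded (hμ : μ ∈ probMeasures J) (hF : ∀ x, |F x| ≤ N) :
    Summable fun x => μ x * F x := by
  refine Summable.of_norm_bounded (hμ.2.summable.mul_right N) fun x => ?_
  rw [Real.norm_eq_abs, abs_mul, abs_of_nonneg (hμ.1 x)]
  exact mul_le_mul_of_nonneg_left (hF x) (hμ.1 x)

lemma mean_const (hμ : μ ∈ probMeasures J) (c : ℝ) : mean μ (fun _ => c) = c := by
  simp [mean, tsum_mul_right, hμ.2.tsum_eq]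

lemma mean_mono (hμ : μ ∈ probMeasures J) (hs : Summable fun x => μ x * F x)
    (hs' : Summable fun x => μ x * F' x) (h : ∀ x, F x ≤ F' x) : mean μ F ≤ mean μ F' :=
  hs.tsum_le_tsum (fun x => mul_le_mul_of_nonneg_left (h x) (hμ.1 x)) hs'

lemma mean_add (hs : Summable fun x => μ x * F x) (hs' : Summable fun x => μ x * F' x) :
    mean μ (fun x => F x + F' x) = mean μ F + mean μ F' := by
  simp only [mean, mul_add]
  exact hs.tsum_add hs'

lemma mean_sub (hs : Summable fun x => μ x * F x) (hs' : Summable fun x => μ x * F' x) :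
    mean μ (fun x => F x - F' x) = mean μ F - mean μ F' := by
  simp only [mean, mul_sub]
  exact hs.tsum_sub hs'

lemma mean_mul_left (c : ℝ) : mean μ (fun x => c * F x) = c * mean μ F := by
  simp only [mean, mul_left_comm _ c, tsum_mul_left]

lemma mean_nonneg (hμ : μ ∈ probMeasures J) (h : ∀ x, 0 ≤ F x) : 0 ≤ mean μ F :=
  tsum_nonneg fun x => mul_nonneg (hμ.1 x) (h x)

lemma mean_le_of_le (hμ : μ ∈ probMeasures J) (hs : Summable fun x => μ x * F x)
    (h : ∀ x, F x ≤ N) : mean μ F ≤ N := by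
  rw [← mean_const hμ N]
  exact mean_mono hμ hs (hμ.2.summable.mul_right N) h

lemma abs_mean_le (hμ : μ ∈ probMeasures J) (hF : ∀ x, |F x| ≤ N) : |mean μ F| ≤ N := by
  have hs := summable_mul_of_bounded hμ hF
  refine abs_le.2 ⟨?_, mean_le_of_le hμ hs fun x => (abs_le.1 (hF x)).2⟩
  rw [← mean_const hμ (-N)]
  exact mean_mono hμ (hμ.2.summable.mul_right _) hs fun x => (abs_le.1 (hF x)).1

lemma mean_sum {ι : Type*} (s : Finset ι) {f : ι → List J → ℝ}
    (hs : ∀ i ∈ s, Summable fun x => μ x * f i x) :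
    mean μ (fun x => ∑ i ∈ s, f i x) = ∑ i ∈ s, mean μ (f i) := by
  simp only [mean, Finset.mul_sum]
  exact Summable.tsum_finsetSum hs

end Mean

lemma hasSum_pointMass_mul [DecidableEq J] (F : List J → ℝ) (z : List J) :
    HasSum (fun y => pointMass z y * F y) (F z) := by
  convert hasSum_ite_eq z (F z) using 2 with y
  unfold pointMass
  split_ifs with h <;> simp [h]

variable [Fintype J] [DecidableEq J] (G : Network J)

/-- The generator of a single queue with arrival rates `v`, applied to the function `F`. -/
def Network.gen (v : J → ℝ) (F : List J → ℝ) (x : List J) : ℝ :=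
  (∑ r : Fin x.length, G.rate x r * (F (x.eraseIdx r) - F x)) + ∑ j, v j * (F (x ++ [j]) - F x)

/-- The total service rate of a queue. -/
def Network.service (x : List J) : ℝ := ∑ r, G.rate x r

lemma Network.service_nonneg (x : List J) : 0 ≤ G.service x :=
  Finset.sum_nonneg fun r _ => G.rate_nonneg x r

lemma Network.service_nil : G.service [] = 0 := by
  unfold Network.service
  exact Finset.sum_eq_zero fun r _ => r.elim0

/-- The rate at which mass is transported from `x` to `y`, with the total rate out of `x`
counted negatively at `y = x`. -/
def Network.kernel (v : J → ℝ) (x y : List J) : ℝ :=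
  (∑ r : Fin x.length, G.rate x r * (pointMass (x.eraseIdx r) y - pointMass x y)) +
    ∑ j, v j * (pointMass (x ++ [j]) y - pointMass x y)

lemma Network.drift_eq_tsum (a : J → ℝ) (μ : List J → ℝ) (y : List J) :
    G.drift a μ y = ∑' x, μ x * G.kernel (G.inflow a μ) x y := rfl

lemma Network.hasSum_kernel_mul (v : J → ℝ) (F : List J → ℝ) (x : List J) :
    HasSum (fun y => G.kernel v x y * F y) (G.gen v F x) := by
  have key (z : List J) : HasSum (fun y => (pointMass z y - pointMass x y) * F y) (F z - F x) := by
    simpa only [sub_mul] using (hasSum_pointMass_mul F z).sub (hasSum_pointMass_mul F x)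
  unfold Network.gen Network.kernel
  simp only [add_mul, Finset.sum_mul, mul_assoc]
  exact (hasSum_sum fun r _ => (key _).mul_left _).add (hasSum_sum fun j _ => (key _).mul_left _)

lemma Network.summable_abs_kernel (v : J → ℝ) (hv : ∀ j, 0 ≤ v j) (x : List J) :
    Summable (fun y => |G.kernel v x y|) ∧
      ∑' y, |G.kernel v x y| ≤ 2 * (G.service x + ∑ j, v j) := by
  have h1 (z : List J) : HasSum (fun y => pointMass z y) (1 : ℝ) := by
    simpa using hasSum_pointMass_mul (fun _ => 1) z
  have h2 (z : List J) : HasSum (fun y => pointMass z y + pointMass x y) (2 : ℝ) := by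
    have := (h1 z).add (h1 x)
    norm_num at this
    exact this
  have hb (z y : List J) : |pointMass z y - pointMass x y| ≤ pointMass z y + pointMass x y := by
    unfold pointMass
    split_ifs <;> norm_num
  have hs : HasSum (fun y => (∑ r : Fin x.length,
      G.rate x r * (pointMass (x.eraseIdx r) y + pointMass x y)) +
      ∑ j, v j * (pointMass (x ++ [j]) y + pointMass x y)) (2 * (G.service x + ∑ j, v j)) := by
    have := (hasSum_sum fun (r : Fin x.length) (_ : r ∈ Finset.univ) =>
      (h2 (x.eraseIdx r)).mul_left (G.rate x r)).add
      (hasSum_sum fun (j : J) (_ : j ∈ Finset.univ) => (h2 (x ++ [j])).mul_left (v j))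
    have e : ∑ r, G.rate x r * 2 + ∑ j, v j * 2 = 2 * (G.service x + ∑ j, v j) := by
      rw [← Finset.sum_mul, ← Finset.sum_mul, Network.service]
      ring
    rwa [e] at this
  have hle (y : List J) : |G.kernel v x y| ≤ (∑ r : Fin x.length,
      G.rate x r * (pointMass (x.eraseIdx r) y + pointMass x y)) +
      ∑ j, v j * (pointMass (x ++ [j]) y + pointMass x y) := by
    refine (abs_add_le _ _).trans (add_le_add ?_ ?_)
    · refine (Finset.abs_sum_le_sum_abs _ _).trans (Finset.sum_le_sum fun r _ => ?_)
      rw [abs_mul, abs_of_nonneg (G.rate_nonneg x r)]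
      exact mul_le_mul_of_nonneg_left (hb _ _) (G.rate_nonneg x r)
    · refine (Finset.abs_sum_le_sum_abs _ _).trans (Finset.sum_le_sum fun j _ => ?_)
      rw [abs_mul, abs_of_nonneg (hv j)]
      exact mul_le_mul_of_nonneg_left (hb _ _) (hv j)
  have hsum := Summable.of_nonneg_of_le (fun y => abs_nonneg _) hle hs.summable
  exact ⟨hsum, (hsum.tsum_le_tsum hle hs.summable).trans_eq hs.tsum_eq⟩

/-- Duality between the evolution equations and the generator, for bounded functions; the second
part bounds the total variation of the velocity. -/
lemma Network.tsum_drift_mul {μ : List J → ℝ} (hμ : μ ∈ probMeasures J) {a : J → ℝ} {γ B N : ℝ}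
    (hγ : ∀ x, G.service x ≤ γ) (hv : ∀ j, 0 ≤ G.inflow a μ j) (hB : ∑ j, G.inflow a μ j ≤ B)
    {F : List J → ℝ} (hF : ∀ x, |F x| ≤ N) :
    HasSum (fun y => G.drift a μ y * F y) (mean μ (G.gen (G.inflow a μ) F)) ∧
      Summable (fun y => |G.drift a μ y|) ∧ ∑' y, |G.drift a μ y| ≤ 2 * (γ + B) := by
  obtain ⟨v, hvdef⟩ : ∃ v, v = G.inflow a μ := ⟨_, rfl⟩
  rw [← hvdef] at hv hB ⊢
  obtain ⟨k, hk⟩ : ∃ k, k = G.kernel v := ⟨_, rfl⟩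
  have hk1 (x : List J) : Summable (fun y => |k x y|) :=
    hk ▸ (G.summable_abs_kernel v hv x).1
  have hk2 (x : List J) : ∑' y, |k x y| ≤ 2 * (γ + B) :=
    hk ▸ (G.summable_abs_kernel v hv x).2.trans (by linarith [hγ x])
  have hd (y : List J) : G.drift a μ y = ∑' x, μ x * k x y :=
    hk ▸ hvdef ▸ G.drift_eq_tsum a μ y
  have hprod : Summable fun p : List J × List J => μ p.1 * |k p.1 p.2| := by
    have h0 (p : List J × List J) : 0 ≤ μ p.1 * |k p.1 p.2| :=
      mul_nonneg (hμ.1 p.1) (abs_nonneg _)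
    have h1 (x : List J) : Summable fun y => μ x * |k x y| := (hk1 x).mul_left (μ x)
    refine (summable_prod_of_nonneg h0).2 ⟨h1, ?_⟩
    simp only [tsum_mul_left]
    exact Summable.of_nonneg_of_le (fun x => mul_nonneg (hμ.1 x) (tsum_nonneg fun _ => abs_nonneg _))
      (fun x => mul_le_mul_of_nonneg_left (hk2 x) (hμ.1 x)) (hμ.2.summable.mul_right _)
  have hswap : Summable fun p : List J × List J => μ p.2 * |k p.2 p.1| :=
    hprod.prod_symm
  have habs (y : List J) : Summable fun x => μ x * |k x y| := hswap.prod_factor y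
  have hle (y : List J) : |G.drift a μ y| ≤ ∑' x, μ x * |k x y| := by
    have := norm_tsum_le_tsum_norm (f := fun x => μ x * k x y) (by
      simpa [abs_mul, abs_of_nonneg (hμ.1 _)] using habs y)
    simpa [hd, abs_mul, abs_of_nonneg (hμ.1 _)] using this
  have hsd : Summable fun y => |G.drift a μ y| :=
    Summable.of_nonneg_of_le (fun _ => abs_nonneg _) hle hswap.prod
  refine ⟨?_, hsd, ?_⟩
  · have hp : Summable fun p : List J × List J => μ p.1 * k p.1 p.2 * F p.2 := by
      refine Summable.of_norm_bounded (hprod.mul_right N) fun p => ?_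
      rw [Real.norm_eq_abs, abs_mul, abs_mul, abs_of_nonneg (hμ.1 _)]
      exact mul_le_mul_of_nonneg_left (hF _) (mul_nonneg (hμ.1 _) (abs_nonneg _))
    have hs : Summable fun y => G.drift a μ y * F y := by
      refine Summable.of_norm_bounded (hsd.mul_right N) fun y => ?_
      rw [Real.norm_eq_abs, abs_mul]
      exact mul_le_mul_of_nonneg_left (hF _) (abs_nonneg _)
    have := Summable.tsum_comm (f := fun x y => μ x * k x y * F y) hp
    have e1 : ∑' y, ∑' x, μ x * k x y * F y = ∑' y, G.drift a μ y * F y := by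
      simp only [tsum_mul_right, hd]
    have e2 : ∑' x, ∑' y, μ x * k x y * F y = mean μ (G.gen v F) := by
      refine tsum_congr fun x => ?_
      simp only [mul_assoc, tsum_mul_left]
      rw [hk, (G.hasSum_kernel_mul v F x).tsum_eq]
    rw [← e2, ← this, e1]
    exact hs.hasSum
  · calc ∑' y, |G.drift a μ y| ≤ ∑' y, ∑' x, μ x * |k x y| := hsd.tsum_le_tsum hle hswap.prod
      _ = ∑' x, ∑' y, μ x * |k x y| :=
        Summable.tsum_comm (f := fun x y => μ x * |k x y|) hprod
      _ = mean μ fun x => ∑' y, |k x y| := by simp only [tsum_mul_left]; rfl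
      _ ≤ 2 * (γ + B) := mean_le_of_le hμ (summable_mul_of_bounded hμ (N := 2 * (γ + B))
          fun x => by
            rw [abs_of_nonneg (tsum_nonneg fun _ => abs_nonneg _)]; exact hk2 x) hk2

end

/-! ### Dynkin's formula for bounded functions -/

noncomputable section

variable {J : Type*} [Fintype J] [DecidableEq J] (G : Network J)

/-- The total rate at which customers of class `i` are served in a queue. -/
def Network.classService (i : J) (x : List J) : ℝ :=
  ∑ r : Fin x.length, if x.get r = i then G.rate x r else 0

lemma Network.outflow_eq_mean (μ : List J → ℝ) (i : J) :
    G.outflow μ i = mean μ (G.classService i) := rfl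

lemma Network.classService_nonneg (i : J) (x : List J) : 0 ≤ G.classService i x :=
  Finset.sum_nonneg fun r _ => by split_ifs; exacts [G.rate_nonneg x r, le_rfl]

lemma Network.sum_classService_mul (h : J → ℝ) (x : List J) :
    ∑ i, G.classService i x * h i = ∑ r, G.rate x r * h (x.get r) := by
  simp only [Network.classService, Finset.sum_mul]
  rw [Finset.sum_comm]
  refine Finset.sum_congr rfl fun r _ => ?_
  simp [ite_mul]

lemma Network.sum_classService (x : List J) : ∑ i, G.classService i x = G.service x := by
  simpa [Network.service] using G.sum_classService_mul (fun _ => 1) x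

lemma Network.classService_le (i : J) (x : List J) : G.classService i x ≤ G.service x := by
  rw [← G.sum_classService]
  exact Finset.single_le_sum (fun i _ => G.classService_nonneg i x) (Finset.mem_univ i)

section State

variable {G} {μ : List J → ℝ} {γ : ℝ}

lemma abs_classService_le (hγ : ∀ x, G.service x ≤ γ) (i : J) (x : List J) :
    |G.classService i x| ≤ γ := by
  rw [abs_of_nonneg (G.classService_nonneg i x)]
  exact (G.classService_le i x).trans (hγ x)

lemma abs_service_le (hγ : ∀ x, G.service x ≤ γ) (x : List J) : |G.service x| ≤ γ := by
  rw [abs_of_nonneg (G.service_nonneg x)]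
  exact hγ x

lemma outflow_nonneg (hμ : μ ∈ probMeasures J) (i : J) : 0 ≤ G.outflow μ i :=
  mean_nonneg hμ (G.classService_nonneg i)

lemma sum_outflow_mul (hγ : ∀ x, G.service x ≤ γ) (hμ : μ ∈ probMeasures J) (h : J → ℝ) :
    ∑ i, G.outflow μ i * h i = mean μ fun x => ∑ r, G.rate x r * h (x.get r) := by
  simp only [← G.sum_classService_mul]
  rw [mean_sum]
  · refine Finset.sum_congr rfl fun i _ => ?_
    simp only [mul_comm _ (h i), mean_mul_left, G.outflow_eq_mean]
  · intro i _
    simp only [← mul_assoc]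
    exact (summable_mul_of_bounded hμ (abs_classService_le hγ i)).mul_right _

lemma sum_outflow (hγ : ∀ x, G.service x ≤ γ) (hμ : μ ∈ probMeasures J) :
    ∑ i, G.outflow μ i = mean μ G.service := by
  simpa [Network.service] using! sum_outflow_mul hγ hμ (fun _ => 1)

lemma mean_service_le (hγ : ∀ x, G.service x ≤ γ) (hμ : μ ∈ probMeasures J) :
    mean μ G.service ≤ γ :=
  mean_le_of_le hμ (summable_mul_of_bounded hμ (abs_service_le hγ)) hγ

lemma inflow_nonneg (hμ : μ ∈ probMeasures J) {a : J → ℝ} (ha : ∀ j, 0 ≤ a j) (j : J) :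
    0 ≤ G.inflow a μ j :=
  add_nonneg (ha j) (Finset.sum_nonneg fun i _ =>
    mul_nonneg (G.routing_nonneg i j) (outflow_nonneg hμ i))

lemma sum_inflow_mul (a h : J → ℝ) :
    ∑ j, G.inflow a μ j * h j =
      ∑ j, a j * h j + ∑ i, G.outflow μ i * ∑ j, G.routing i j * h j := by
  simp only [Network.inflow, add_mul, Finset.sum_add_distrib, Finset.sum_mul, Finset.mul_sum]
  congr 1
  rw [Finset.sum_comm]
  exact Finset.sum_congr rfl fun i _ => Finset.sum_congr rfl fun j _ => by ring

lemma sum_inflow_le (hγ : ∀ x, G.service x ≤ γ) (hμ : μ ∈ probMeasures J) {a : J → ℝ} {ε : ℝ}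
    (ha : ∀ j, a j ≤ ε) :
    ∑ j, G.inflow a μ j ≤ Fintype.card J * ε + mean μ G.service := by
  have := sum_inflow_mul (G := G) (μ := μ) a (fun _ => 1)
  simp only [mul_one] at this
  rw [this, ← sum_outflow hγ hμ]
  refine add_le_add ?_ (Finset.sum_le_sum fun i _ =>
    mul_le_of_le_one_right (outflow_nonneg hμ i) (G.routing_sum_le_one i))
  simpa using Finset.sum_le_sum fun j (_ : j ∈ Finset.univ) => ha j

end State

section Evolution

variable {G} {γ ε N : ℝ} {lam : J → ℝ → ℝ} {μ : ℝ → List J → ℝ}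

/-- The total arrival rate at a queue at time `u`. -/
def Network.arrivals (G : Network J) (lam : J → ℝ → ℝ) (μ : ℝ → List J → ℝ) (u : ℝ) : ℝ :=
  ∑ j, G.inflow (fun j => lam j u) (μ u) j

lemma arrivals_nonneg (hl : IsExternalInflow lam ε) (hμ : G.IsNLMP lam μ) {u : ℝ} (hu : 0 ≤ u) :
    0 ≤ G.arrivals lam μ u :=
  Finset.sum_nonneg fun j _ =>
    inflow_nonneg (hμ.mem_probMeasures u hu) (fun j => hl.nonneg j u hu) j

lemma arrivals_le_service (hγ : ∀ x, G.service x ≤ γ) (hl : IsExternalInflow lam ε)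
    (hμ : G.IsNLMP lam μ) {u : ℝ} (hu : 0 ≤ u) :
    G.arrivals lam μ u ≤ Fintype.card J * ε + mean (μ u) G.service :=
  sum_inflow_le hγ (hμ.mem_probMeasures u hu) fun j => hl.le j u hu

lemma arrivals_le (hγ : ∀ x, G.service x ≤ γ) (hl : IsExternalInflow lam ε)
    (hμ : G.IsNLMP lam μ) {u : ℝ} (hu : 0 ≤ u) :
    G.arrivals lam μ u ≤ Fintype.card J * ε + γ :=
  (arrivals_le_service hγ hl hμ hu).trans
    (by gcongr; exact mean_service_le hγ (hμ.mem_probMeasures u hu))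

/-- Dynkin's formula for bounded functions of the queue. -/
lemma mean_sub_mean_eq_integral (hγ : ∀ x, G.service x ≤ γ) (hl : IsExternalInflow lam ε)
    (hμ : G.IsNLMP lam μ) {F : List J → ℝ} (hF : ∀ x, |F x| ≤ N) {s t : ℝ} (hs : 0 ≤ s)
    (hst : s ≤ t) :
    IntervalIntegrable (fun u => mean (μ u) (G.gen (G.inflow (fun j => lam j u) (μ u)) F))
      MeasureTheory.volume s t ∧
    mean (μ t) F - mean (μ s) F =
      ∫ u in s..t, mean (μ u) (G.gen (G.inflow (fun j => lam j u) (μ u)) F) := by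
  have hN : 0 ≤ N := (abs_nonneg _).trans (hF [])
  set d : List J → ℝ → ℝ := fun y u => G.drift (fun j => lam j u) (μ u) y with hd
  have hint (y : List J) : IntervalIntegrable (d y) MeasureTheory.volume s t :=
    (hμ.intervalIntegrable y s hs).symm.trans (hμ.intervalIntegrable y t (hs.trans hst))
  have hdiff (y : List J) : μ t y - μ s y = ∫ u in s..t, d y u := by
    rw [hμ.eq_integral y t (hs.trans hst), hμ.eq_integral y s hs,
      ← intervalIntegral.integral_interval_sub_left (hμ.intervalIntegrable y t (hs.trans hst))
        (hμ.intervalIntegrable y s hs)]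
    ring
  have hdual (u : ℝ) (hu : u ∈ Set.uIoc s t) := by
    rw [Set.uIoc_of_le hst] at hu
    have hu0 : 0 ≤ u := hs.trans hu.1.le
    exact G.tsum_drift_mul (hμ.mem_probMeasures u hu0) hγ
      (inflow_nonneg (hμ.mem_probMeasures u hu0) fun j => hl.nonneg j u hu0)
      (arrivals_le hγ hl hμ hu0) hF
  have hmeas (y : List J) : MeasureTheory.AEStronglyMeasurable (d y)
      (MeasureTheory.volume.restrict (Set.uIoc s t)) := (hint y).def'.aestronglyMeasurable
  have hbd : IntervalIntegrable (fun u => ∑' y, |d y u| * N) MeasureTheory.volume s t := by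
    refine (intervalIntegrable_const (c := 2 * (γ + (Fintype.card J * ε + γ)) * N)).mono_fun
      (AEMeasurable.tsum fun y => ((hmeas y).norm.mul_const N).aemeasurable).aestronglyMeasurable ?_
    refine (MeasureTheory.ae_restrict_iff' measurableSet_uIoc).2 (.of_forall fun u hu => ?_)
    beta_reduce
    rw [tsum_mul_right, Real.norm_eq_abs, Real.norm_eq_abs, abs_of_nonneg
      (mul_nonneg (tsum_nonneg fun _ => abs_nonneg _) hN)]
    exact (mul_le_mul_of_nonneg_right (hdual u hu).2.2 hN).trans (le_abs_self _)
  have hsum := intervalIntegral.hasSum_integral_of_dominated_convergence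
    (μ := MeasureTheory.volume) (a := s) (b := t) (F := fun y u => d y u * F y)
    (fun y u => |d y u| * N) (fun y => (hmeas y).mul_const _)
    (fun y => .of_forall fun u _ => by
      rw [norm_mul]; exact mul_le_mul_of_nonneg_left (hF y) (abs_nonneg _))
    (.of_forall fun u hu => (hdual u hu).2.1.mul_right N) hbd
    (.of_forall fun u hu => (hdual u hu).1)
  constructor
  · refine hbd.mono_fun ?_ ?_
    · refine (AEMeasurable.tsum fun y => ((hmeas y).mul_const (F y)).aemeasurable
        : AEMeasurable (fun u => ∑' y, d y u * F y) _).aestronglyMeasurable.congr ?_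
      exact (MeasureTheory.ae_restrict_iff' measurableSet_uIoc).2
        (.of_forall fun u hu => (hdual u hu).1.tsum_eq)
    · refine (MeasureTheory.ae_restrict_iff' measurableSet_uIoc).2 (.of_forall fun u hu => ?_)
      beta_reduce
      rw [← (hdual u hu).1.tsum_eq]
      have hs := (hdual u hu).2.1.mul_right N
      refine (norm_tsum_le_tsum_norm ?_).trans ((Summable.tsum_le_tsum ?_ ?_ hs).trans
        (le_abs_self _))
      · refine Summable.of_nonneg_of_le (fun _ => norm_nonneg _) (fun y => ?_) hs
        rw [norm_mul]; exact mul_le_mul_of_nonneg_left (hF y) (abs_nonneg _)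
      · intro y
        rw [norm_mul]; exact mul_le_mul_of_nonneg_left (hF y) (abs_nonneg _)
      · refine Summable.of_nonneg_of_le (fun _ => norm_nonneg _) (fun y => ?_) hs
        rw [norm_mul]; exact mul_le_mul_of_nonneg_left (hF y) (abs_nonneg _)
  · rw [← hsum.tsum_eq, mean, mean, ← (summable_mul_of_bounded
      (hμ.mem_probMeasures t (hs.trans hst)) hF).tsum_sub
      (summable_mul_of_bounded (hμ.mem_probMeasures s hs) hF)]
    refine tsum_congr fun y => ?_
    rw [intervalIntegral.integral_mul_const, ← hdiff]
    ring

lemma abs_gen_le (hγ : ∀ x, G.service x ≤ γ) {v : J → ℝ} (hv : ∀ j, 0 ≤ v j) {B : ℝ}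
    (hB : ∑ j, v j ≤ B) {F : List J → ℝ} (hF : ∀ x, |F x| ≤ N) (x : List J) :
    |G.gen v F x| ≤ 2 * (γ + B) * N := by
  have hN : 0 ≤ N := (abs_nonneg _).trans (hF [])
  have hb (z : List J) : |F z - F x| ≤ 2 * N := by
    have := abs_sub (F z) (F x)
    linarith [hF z, hF x]
  have h1 : |∑ r : Fin x.length, G.rate x r * (F (x.eraseIdx r) - F x)| ≤
      G.service x * (2 * N) := by
    rw [Network.service, Finset.sum_mul]
    refine (Finset.abs_sum_le_sum_abs _ _).trans (Finset.sum_le_sum fun r _ => ?_)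
    rw [abs_mul, abs_of_nonneg (G.rate_nonneg x r)]
    exact mul_le_mul_of_nonneg_left (hb _) (G.rate_nonneg x r)
  have h2 : |∑ j, v j * (F (x ++ [j]) - F x)| ≤ (∑ j, v j) * (2 * N) := by
    rw [Finset.sum_mul]
    refine (Finset.abs_sum_le_sum_abs _ _).trans (Finset.sum_le_sum fun j _ => ?_)
    rw [abs_mul, abs_of_nonneg (hv j)]
    exact mul_le_mul_of_nonneg_left (hb _) (hv j)
  calc |G.gen v F x| ≤ G.service x * (2 * N) + (∑ j, v j) * (2 * N) :=
        (abs_add_le _ _).trans (add_le_add h1 h2)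
    _ ≤ γ * (2 * N) + B * (2 * N) := by gcongr; exact hγ x
    _ = 2 * (γ + B) * N := by ring

/-- The state is Lipschitz in time, in the total variation norm. -/
lemma abs_mean_sub_mean_le (hγ : ∀ x, G.service x ≤ γ) (hl : IsExternalInflow lam ε)
    (hμ : G.IsNLMP lam μ) {F : List J → ℝ} (hF : ∀ x, |F x| ≤ N) {s t : ℝ} (hs : 0 ≤ s)
    (hst : s ≤ t) :
    |mean (μ t) F - mean (μ s) F| ≤ 2 * (γ + (Fintype.card J * ε + γ)) * N * (t - s) := by
  rw [(mean_sub_mean_eq_integral hγ hl hμ hF hs hst).2]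
  rw [← Real.norm_eq_abs, ← abs_of_nonneg (sub_nonneg.2 hst)]
  refine intervalIntegral.norm_integral_le_of_norm_le_const fun u hu => ?_
  rw [Set.uIoc_of_le hst] at hu
  have hu0 : 0 ≤ u := hs.trans hu.1.le
  exact abs_mean_le (hμ.mem_probMeasures u hu0) fun x => abs_gen_le hγ
    (inflow_nonneg (hμ.mem_probMeasures u hu0) fun j => hl.nonneg j u hu0)
    (arrivals_le hγ hl hμ hu0) hF x

lemma continuousOn_mean (hγ : ∀ x, G.service x ≤ γ) (hl : IsExternalInflow lam ε)
    (hμ : G.IsNLMP lam μ) {F : List J → ℝ} (hF : ∀ x, |F x| ≤ N) :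
    ContinuousOn (fun u => mean (μ u) F) (Set.Ici 0) := by
  obtain ⟨K, hK⟩ : ∃ K : ℝ, K = 2 * (γ + (Fintype.card J * ε + γ)) * N := ⟨_, rfl⟩
  have hle (s t : ℝ) (hs : 0 ≤ s) (hst : s ≤ t) :
      |mean (μ t) F - mean (μ s) F| ≤ K.toNNReal * (t - s) :=
    (hK ▸ abs_mean_sub_mean_le hγ hl hμ hF hs hst).trans
      (mul_le_mul_of_nonneg_right (Real.le_coe_toNNReal K) (sub_nonneg.2 hst))
  refine (LipschitzOnWith.of_dist_le_mul (K := K.toNNReal) fun s hs t ht => ?_).continuousOn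
  rw [Real.dist_eq, Real.dist_eq]
  rcases le_total s t with h | h
  · rw [abs_sub_comm, abs_sub_comm s, abs_of_nonneg (sub_nonneg.2 h)]
    exact hle s t hs h
  · rw [abs_of_nonneg (sub_nonneg.2 h)]
    exact hle t s ht h

lemma intervalIntegrable_mean (hγ : ∀ x, G.service x ≤ γ) (hl : IsExternalInflow lam ε)
    (hμ : G.IsNLMP lam μ) {F : List J → ℝ} (hF : ∀ x, |F x| ≤ N) {s t : ℝ} (hs : 0 ≤ s)
    (hst : s ≤ t) : IntervalIntegrable (fun u => mean (μ u) F) MeasureTheory.volume s t := by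
  refine ((continuousOn_mean hγ hl hμ hF).mono ?_).intervalIntegrable
  rw [Set.uIcc_of_le hst]
  exact fun u hu => hs.trans hu.1

lemma intervalIntegrable_arrivals (hγ : ∀ x, G.service x ≤ γ) (hl : IsExternalInflow lam ε)
    (hμ : G.IsNLMP lam μ) {s t : ℝ} (hs : 0 ≤ s) (hst : s ≤ t) :
    IntervalIntegrable (G.arrivals lam μ) MeasureTheory.volume s t := by
  have hlam (j : J) : IntervalIntegrable (lam j) MeasureTheory.volume s t := by
    refine (intervalIntegrable_const (c := ε)).mono_fun
      (hl.measurable j).aestronglyMeasurable ?_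
    refine (MeasureTheory.ae_restrict_iff' measurableSet_uIoc).2 (.of_forall fun u hu => ?_)
    rw [Set.uIoc_of_le hst] at hu
    have hu0 : 0 ≤ u := hs.trans hu.1.le
    beta_reduce
    rw [Real.norm_eq_abs, Real.norm_eq_abs, abs_of_nonneg (hl.nonneg j u hu0)]
    exact (hl.le j u hu0).trans (le_abs_self _)
  have hout (i : J) : IntervalIntegrable (fun u => G.outflow (μ u) i)
      MeasureTheory.volume s t :=
    intervalIntegrable_mean hγ hl hμ (abs_classService_le hγ i) hs hst
  have hint (j : J) : IntervalIntegrable (fun u => G.inflow (fun j => lam j u) (μ u) j)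
      MeasureTheory.volume s t := by
    refine (hlam j).add ?_
    simpa only [Finset.sum_fn] using IntervalIntegrable.sum Finset.univ
      (f := fun (i : J) u => G.routing i j * G.outflow (μ u) i) fun i _ => (hout i).const_mul _
  simpa only [Finset.sum_fn] using! IntervalIntegrable.sum Finset.univ fun j _ => hint j

end Evolution

end

/-! ### Length and weight of a queue -/

noncomputable section

variable {J : Type*}

/-- The weight of a queue, when a customer of class `j` has weight `h j`. -/
def weight (h : J → ℝ) (x : List J) : ℝ := (x.map h).sum

lemma weight_append (h : J → ℝ) (x : List J) (j : J) : weight h (x ++ [j]) = weight h x + h j := by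
  simp [weight]

lemma weight_eraseIdx (h : J → ℝ) (x : List J) (r : Fin x.length) :
    weight h (x.eraseIdx r) = weight h x - h (x.get r) := by
  have := ((List.getElem_cons_eraseIdx_perm r.2).map h).sum_eq
  simp only [List.map_cons, List.sum_cons] at this
  simp only [weight, List.get_eq_getElem]
  linarith

lemma length_le_weight {h : J → ℝ} (h1 : ∀ j, 1 ≤ h j) (x : List J) :
    (x.length : ℝ) ≤ weight h x := by
  induction x with
  | nil => simp [weight]
  | cons j x ih =>
    simp only [weight, List.map_cons, List.sum_cons, List.length_cons, Nat.cast_add,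
      Nat.cast_one] at ih ⊢
    linarith [h1 j]

lemma weight_le_length {h : J → ℝ} {c : ℝ} (hc : ∀ j, h j ≤ c) (x : List J) :
    weight h x ≤ c * x.length := by
  induction x with
  | nil => simp [weight]
  | cons j x ih =>
    simp only [weight, List.map_cons, List.sum_cons, List.length_cons, Nat.cast_add,
      Nat.cast_one] at ih ⊢
    linarith [hc j]

variable [Fintype J] [DecidableEq J] {G : Network J}
  {γ γm ε N : ℝ} {lam : J → ℝ → ℝ} {μ : ℝ → List J → ℝ}

/-- On increasing functions of the length, the generator is dominated by that of a single-server
queue with service rate `γm`. At length `0` the truncated subtraction makes the first term vanish,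
as it should. -/
lemma gen_length_le (hγm : ∀ x : List J, x ≠ [] → γm ≤ G.service x) {F : ℕ → ℝ}
    (hF : Monotone F) (v : J → ℝ) (x : List J) :
    G.gen v (fun y => F y.length) x ≤
      γm * (F (x.length - 1) - F x.length) + (∑ j, v j) * (F (x.length + 1) - F x.length) := by
  have h1 : ∑ r : Fin x.length, G.rate x r * (F (x.eraseIdx r).length - F x.length) =
      G.service x * (F (x.length - 1) - F x.length) := by
    rw [Network.service, Finset.sum_mul]
    exact Finset.sum_congr rfl fun r _ => by rw [List.length_eraseIdx_of_lt r.2]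
  have h2 : ∑ j, v j * (F (x ++ [j]).length - F x.length) =
      (∑ j, v j) * (F (x.length + 1) - F x.length) := by
    simp [Finset.sum_mul]
  rw [Network.gen, h1, h2]
  gcongr ?_ + _
  by_cases hx : x = []
  · simp [hx]
  · exact mul_le_mul_of_nonpos_right (hγm x hx) (sub_nonpos.2 (hF (Nat.sub_le _ _)))

/-- The mean of an increasing function of the length after a short time is at most that after one
Euler step of the single-server queue, with the arrivals of the whole step lumped together. The
error is quadratic in the step, uniformly in the function and the initial time. -/
lemma mean_length_le (hγ : ∀ x, G.service x ≤ γ) (hγm0 : 0 ≤ γm)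
    (hγm : ∀ x : List J, x ≠ [] → γm ≤ G.service x) (hl : IsExternalInflow lam ε)
    (hμ : G.IsNLMP lam μ) {F : ℕ → ℝ} (hF : Monotone F) (hN : ∀ n, |F n| ≤ N) {s t : ℝ}
    (hs : 0 ≤ s) (hst : s ≤ t) :
    mean (μ t) (fun x => F x.length) ≤ mean (μ s) (fun x => F x.length
      + γm * (t - s) * (F (x.length - 1) - F x.length)
      + (∫ u in s..t, G.arrivals lam μ u) * (F (x.length + 1) - F x.length))
      + (γm + (Fintype.card J * ε + γ)) *
        (2 * (γ + (Fintype.card J * ε + γ)) * (2 * N)) * (t - s) ^ 2 := by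
  set B := Fintype.card J * ε + γ with hB
  set K := 2 * (γ + B) * (2 * N) with hK
  set D₁ : List J → ℝ := fun x => F (x.length - 1) - F x.length with hD₁
  set D₂ : List J → ℝ := fun x => F (x.length + 1) - F x.length with hD₂
  have hd (m n : ℕ) : |F m - F n| ≤ 2 * N := by
    have := abs_sub (F m) (F n)
    linarith [hN m, hN n]
  have hb₁ (x : List J) : |D₁ x| ≤ 2 * N := hd _ _
  have hb₂ (x : List J) : |D₂ x| ≤ 2 * N := hd _ _
  have hFb (x : List J) : |F x.length| ≤ N := hN _
  obtain ⟨hint, hdyn⟩ := mean_sub_mean_eq_integral hγ hl hμ hFb hs hst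
  have hsm (u : ℝ) (hu : 0 ≤ u) {F' : List J → ℝ} {C : ℝ} (h : ∀ x, |F' x| ≤ C) :=
    summable_mul_of_bounded (hμ.mem_probMeasures u hu) h
  have hVint := intervalIntegrable_arrivals hγ hl hμ hs hst
  have hK0 : 0 ≤ K * (t - s) :=
    (abs_nonneg _).trans (abs_mean_sub_mean_le hγ hl hμ hb₁ hs hst)
  have hle (u : ℝ) (hu : u ∈ Set.Icc s t) :
      mean (μ u) (G.gen (G.inflow (fun j => lam j u) (μ u)) fun x => F x.length) ≤
        γm * (mean (μ s) D₁ + K * (t - s)) +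
          G.arrivals lam μ u * (mean (μ s) D₂ + K * (t - s)) := by
    have hu0 : 0 ≤ u := hs.trans hu.1
    have hV0 := arrivals_nonneg hl hμ hu0
    have hp := hμ.mem_probMeasures u hu0
    have hinf := inflow_nonneg (G := G) hp fun j => hl.nonneg j u hu0
    have hmono : K * (u - s) ≤ K * (t - s) := by
      have hK' : 0 ≤ K := by
        have h2 : 0 ≤ G.service [] := G.service_nonneg _
        have h3 := hγ []
        have h4 : 0 ≤ B := hV0.trans (arrivals_le hγ hl hμ hu0)
        have h5 : 0 ≤ N := (abs_nonneg _).trans (hN 0)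
        have h6 : 0 ≤ γ := h2.trans h3
        positivity
      exact mul_le_mul_of_nonneg_left (by linarith [hu.2]) hK'
    have hm₁ : mean (μ u) D₁ ≤ mean (μ s) D₁ + K * (t - s) := by
      have := (abs_le.1 (abs_mean_sub_mean_le hγ hl hμ hb₁ hs hu.1)).2
      linarith
    have hm₂ : mean (μ u) D₂ ≤ mean (μ s) D₂ + K * (t - s) := by
      have := (abs_le.1 (abs_mean_sub_mean_le hγ hl hμ hb₂ hs hu.1)).2
      linarith
    have hg : mean (μ u) (G.gen (G.inflow (fun j => lam j u) (μ u)) fun x => F x.length) ≤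
        mean (μ u) fun x => γm * D₁ x + G.arrivals lam μ u * D₂ x := by
      refine mean_mono hp (hsm u hu0 (abs_gen_le hγ hinf le_rfl hFb)) ?_
        (gen_length_le hγm hF _)
      have := ((hsm u hu0 hb₁).mul_left γm).add ((hsm u hu0 hb₂).mul_left (G.arrivals lam μ u))
      exact this.congr fun x => by ring
    rw [mean_add (((hsm u hu0 hb₁).mul_left γm).congr fun x => by ring)
      (((hsm u hu0 hb₂).mul_left (G.arrivals lam μ u)).congr fun x => by ring),
      mean_mul_left, mean_mul_left] at hg
    exact hg.trans (by gcongr)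
  have hI := intervalIntegral.integral_mono_on hst hint
    (intervalIntegrable_const.add (hVint.mul_const _)) hle
  rw [← hdyn, intervalIntegral.integral_add intervalIntegrable_const (hVint.mul_const _),
    intervalIntegral.integral_const, intervalIntegral.integral_mul_const, smul_eq_mul] at hI
  have hW : ∫ u in s..t, G.arrivals lam μ u ≤ B * (t - s) := by
    have := intervalIntegral.integral_mono_on hst hVint (intervalIntegrable_const (c := B))
      fun u hu => arrivals_le hγ hl hμ (hs.trans hu.1)
    rwa [intervalIntegral.integral_const, smul_eq_mul, mul_comm] at this
  have e : mean (μ s) (fun x => F x.length + γm * (t - s) * D₁ x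
      + (∫ u in s..t, G.arrivals lam μ u) * D₂ x) = mean (μ s) (fun x => F x.length)
      + γm * (t - s) * mean (μ s) D₁ + (∫ u in s..t, G.arrivals lam μ u) * mean (μ s) D₂ := by
    have a₁ := ((hsm s hs hb₁).mul_left (γm * (t - s))).congr
      (g := fun x => μ s x * (γm * (t - s) * D₁ x)) fun x => by ring
    have a₂ := ((hsm s hs hb₂).mul_left (∫ u in s..t, G.arrivals lam μ u)).congr
      (g := fun x => μ s x * ((∫ u in s..t, G.arrivals lam μ u) * D₂ x)) fun x => by ring
    rw [mean_add (((hsm s hs hFb).add a₁).congr fun x => by ring) a₂, mean_add (hsm s hs hFb) a₁,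
      mean_mul_left, mean_mul_left]
  rw [e]
  have h3 := mul_le_mul_of_nonneg_right hW hK0
  nlinarith

end

/-! ### The mean weight -/

noncomputable section

variable {J : Type*} [Fintype J] [DecidableEq J] {G : Network J}
  {γ ε N : ℝ} {lam : J → ℝ → ℝ} {μ : ℝ → List J → ℝ}

/-- Since the network is open, the classes can be given weights that a service decreases by at
least `1` in the mean, the rerouted customer included. -/
lemma Network.exists_weight (G : Network J) : ∃ h : J → ℝ, (∀ j, 1 ≤ h j) ∧
    ∀ i, 1 + ∑ j, G.routing i j * h j ≤ h i := by
  let _ : NormedRing (Matrix J J ℂ) := Matrix.linftyOpNormedRing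
  let _ : NormedAlgebra ℂ (Matrix J J ℂ) := Matrix.linftyOpNormedAlgebra
  set P := G.routing with hP
  set A : Matrix J J ℂ := P.map (fun a : ℝ => (a : ℂ)) with hA
  have hr := G.spectralRadius_lt_one
  obtain ⟨n, hn⟩ : ∃ n : ℕ, ‖A ^ n‖ ≤ 1 / 2 := by
    obtain ⟨q, hq1, hq2⟩ := exists_between hr
    have hq0 : q ≠ ⊤ := (hq2.trans ENNReal.one_lt_top).ne
    have hg := spectrum.pow_nnnorm_pow_one_div_tendsto_nhds_spectralRadius A
    have h1 := hg.eventually (gt_mem_nhds hq1)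
    have h2 : Filter.Tendsto (fun n : ℕ => q ^ n) Filter.atTop (nhds 0) :=
      ENNReal.tendsto_pow_atTop_nhds_zero_of_lt_one hq2
    have h3 := h2.eventually (gt_mem_nhds (show (0 : ENNReal) < ((1 / 2 : NNReal) : ENNReal) by
      norm_num))
    obtain ⟨n, ⟨hn1, hn3⟩, hn0⟩ := ((h1.and h3).and (Filter.eventually_gt_atTop 0)).exists
    refine ⟨n, ?_⟩
    have h4 : (‖A ^ n‖₊ : ENNReal) ≤ q ^ n := by
      have := ENNReal.rpow_le_rpow hn1.le (Nat.cast_nonneg (α := ℝ) n)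
      rwa [← ENNReal.rpow_mul, one_div, inv_mul_cancel₀ (by positivity), ENNReal.rpow_one,
        ENNReal.rpow_natCast] at this
    have h5 : ‖A ^ n‖₊ ≤ (1 / 2 : NNReal) := by
      exact_mod_cast h4.trans hn3.le
    exact_mod_cast h5
  have hApow : A ^ n = (P ^ n).map (fun a : ℝ => (a : ℂ)) := by
    have := map_pow (Complex.ofRealHom.mapMatrix (m := J)) P n
    exact this.symm
  have hnn (k : ℕ) : ∀ i j, 0 ≤ (P ^ k) i j := by
    induction k with
    | zero => intro i j; rw [pow_zero, Matrix.one_apply]; split_ifs <;> norm_num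
    | succ k ih =>
      intro i j
      rw [pow_succ, Matrix.mul_apply]
      exact Finset.sum_nonneg fun l _ => mul_nonneg (ih i l) (G.routing_nonneg l j)
  have hrow (i : J) : ∑ j, (P ^ n) i j ≤ 1 / 2 := by
    have h1 : ∑ j, ‖(A ^ n) i j‖₊ ≤ ‖A ^ n‖₊ := by
      rw [Matrix.linfty_opNNNorm_def]
      exact Finset.le_sup (f := fun i => ∑ j, ‖(A ^ n) i j‖₊) (Finset.mem_univ i)
    have h2 : ∑ j, ‖(A ^ n) i j‖ ≤ ‖A ^ n‖ := by
      have := NNReal.coe_le_coe.2 h1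
      rwa [NNReal.coe_sum] at this
    refine le_trans (Finset.sum_le_sum fun j _ => ?_) (h2.trans hn)
    rw [hApow, Matrix.map_apply, Complex.norm_real]
    exact le_abs_self _
  -- Twice a partial sum of the Neumann series suffices.
  set e : J → ℝ := fun _ => 1 with he
  set S : ℕ → J → ℝ := fun k i => ∑ j, (P ^ k) i j with hS
  have hstep (k : ℕ) (i : J) : ∑ j, P i j * S k j = S (k + 1) i := by
    simp only [hS, pow_succ', Matrix.mul_apply, Finset.mul_sum]
    exact Finset.sum_comm
  have h0 (i : J) : S 0 i = 1 := by simp [hS, Matrix.one_apply]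
  have hSn (k : ℕ) (i : J) : 0 ≤ S k i := Finset.sum_nonneg fun j _ => hnn k i j
  have hmain (i : J) : 1 + ∑ j, P i j * (2 * ∑ k ∈ Finset.range n, S k j) ≤
      2 * ∑ k ∈ Finset.range n, S k i := by
    have h1 : ∑ j, P i j * (2 * ∑ k ∈ Finset.range n, S k j) =
        2 * ∑ k ∈ Finset.range n, S (k + 1) i := by
      simp only [← hstep, Finset.mul_sum]
      rw [Finset.sum_comm]
      exact Finset.sum_congr rfl fun k _ => Finset.sum_congr rfl fun j _ => by ring
    have h2 := Finset.sum_range_succ' (fun k => S k i) n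
    rw [Finset.sum_range_succ, h0] at h2
    have h3 : S n i ≤ 1 / 2 := hrow i
    rw [h1]
    linarith
  refine ⟨fun i => 2 * ∑ k ∈ Finset.range n, S k i, fun i => ?_, hmain⟩
  refine le_trans ?_ (hmain i)
  have : 0 ≤ ∑ j, P i j * (2 * ∑ k ∈ Finset.range n, S k j) := Finset.sum_nonneg fun j _ =>
    mul_nonneg (G.routing_nonneg i j) (mul_nonneg zero_le_two
      (Finset.sum_nonneg fun k _ => hSn k j))
  linarith

/-- The truncated weight decreases like the weight, up to an error that is controlled by the
probability that the truncation matters. -/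
lemma gen_truncated_weight_le (hγ : ∀ x, G.service x ≤ γ) {h : J → ℝ} {c : ℝ}
    (h1 : ∀ j, 1 ≤ h j) (hc0 : 0 ≤ c) (hc : ∀ j, h j ≤ c) {v : J → ℝ} (hv : ∀ j, 0 ≤ v j) (hN : 0 < N)
    (x : List J) :
    G.gen v (fun y => min (weight h y) N) x ≤
      ∑ j, v j * h j - ∑ r, G.rate x r * h (x.get r) + γ * (c / N * min (weight h x) N) ∧
    G.gen v (fun y => min (weight h y) N) x ≤ ∑ j, v j * h j := by
  have hw : 0 ≤ weight h x := (Nat.cast_nonneg _).trans (length_le_weight h1 x)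
  have hin : ∑ j, v j * (min (weight h (x ++ [j])) N - min (weight h x) N) ≤ ∑ j, v j * h j := by
    refine Finset.sum_le_sum fun j _ => mul_le_mul_of_nonneg_left ?_ (hv j)
    rw [weight_append, sub_le_iff_le_add]
    have := h1 j
    rcases le_total (weight h x) N with hx | hx
    · rw [min_eq_left hx]; exact (min_le_left _ _).trans (by linarith)
    · rw [min_eq_right hx]; exact (min_le_right _ _).trans (by linarith)
  constructor
  · have hout : ∑ r : Fin x.length, G.rate x r *
        (min (weight h (x.eraseIdx r)) N - min (weight h x) N) ≤
        ∑ r : Fin x.length, G.rate x r * (c / N * min (weight h x) N - h (x.get r)) := by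
      refine Finset.sum_le_sum fun r _ => mul_le_mul_of_nonneg_left ?_ (G.rate_nonneg x r)
      rw [weight_eraseIdx]
      have hr := h1 (x.get r)
      have hr' := hc (x.get r)
      have hcN : 0 ≤ c / N * min (weight h x) N :=
        mul_nonneg (div_nonneg hc0 hN.le) (le_min hw hN.le)
      rcases le_total (weight h x) N with hx | hx
      · have := min_le_left (weight h x - h (x.get r)) N
        rw [min_eq_left hx] at hcN ⊢
        linarith
      · have := min_le_right (weight h x - h (x.get r)) N
        rw [min_eq_right hx, div_mul_cancel₀ _ hN.ne']
        linarith
    have e : ∑ r : Fin x.length, G.rate x r * (c / N * min (weight h x) N - h (x.get r)) =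
        G.service x * (c / N * min (weight h x) N) - ∑ r, G.rate x r * h (x.get r) := by
      simp only [mul_sub, Finset.sum_sub_distrib, Network.service, Finset.sum_mul]
    rw [e] at hout
    have hcN : 0 ≤ c / N * min (weight h x) N :=
      mul_nonneg (div_nonneg hc0 hN.le) (le_min hw hN.le)
    have := mul_le_mul_of_nonneg_right (hγ x) hcN
    unfold Network.gen
    linarith
  · have hout : ∑ r : Fin x.length, G.rate x r *
        (min (weight h (x.eraseIdx r)) N - min (weight h x) N) ≤ 0 := by
      refine Finset.sum_nonpos fun r _ => mul_nonpos_of_nonneg_of_nonpos (G.rate_nonneg x r) ?_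
      rw [weight_eraseIdx]
      exact sub_nonpos.2 (min_le_min_right _ (by linarith [h1 (x.get r)]))
    unfold Network.gen
    linarith

/-- The mean weight stays finite, and it decreases at least at the total service rate, except for
the external arrivals. -/
lemma mean_weight_le (hγ : ∀ x, G.service x ≤ γ) (hl : IsExternalInflow lam ε)
    (hμ : G.IsNLMP lam μ) {h : J → ℝ} {c : ℝ} (h1 : ∀ j, 1 ≤ h j) (hc0 : 0 ≤ c)
    (hc : ∀ j, h j ≤ c)
    (hP : ∀ i, 1 + ∑ j, G.routing i j * h j ≤ h i) {s t : ℝ} (hs : 0 ≤ s) (hst : s ≤ t)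
    (hfin : Summable fun x => μ s x * weight h x) :
    (Summable fun x => μ t x * weight h x) ∧
      mean (μ t) (weight h) ≤ mean (μ s) (weight h) +
        ∫ u in s..t, (ε * ∑ j, h j - mean (μ u) G.service) := by
  have hw (x : List J) : 0 ≤ weight h x := (Nat.cast_nonneg _).trans (length_le_weight h1 x)
  have hp (u : ℝ) (hu : 0 ≤ u) := hμ.mem_probMeasures u hu
  have ht : 0 ≤ t := hs.trans hst
  set M := mean (μ s) (weight h) with hM
  set I := ∫ u in s..t, (ε * ∑ j, h j - mean (μ u) G.service) with hI
  have hint : IntervalIntegrable (fun u => ε * ∑ j, h j - mean (μ u) G.service)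
      MeasureTheory.volume s t :=
    intervalIntegrable_const.sub (intervalIntegrable_mean hγ hl hμ (abs_service_le hγ) hs hst)
  -- A crude bound for the influx of weight.
  obtain ⟨D, hD⟩ : ∃ D, ∀ u, 0 ≤ u →
      ∑ j, G.inflow (fun j => lam j u) (μ u) j * h j ≤ D := by
    refine ⟨(Fintype.card J * ε + γ) * c, fun u hu => ?_⟩
    calc ∑ j, G.inflow (fun j => lam j u) (μ u) j * h j
        ≤ ∑ j, G.inflow (fun j => lam j u) (μ u) j * c :=
          Finset.sum_le_sum fun j _ => mul_le_mul_of_nonneg_left (hc j)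
            (inflow_nonneg (hp u hu) (fun j => hl.nonneg j u hu) j)
      _ = G.arrivals lam μ u * c := by rw [← Finset.sum_mul]; rfl
      _ ≤ (Fintype.card J * ε + γ) * c:=
          mul_le_mul_of_nonneg_right (arrivals_le hγ hl hμ hu) hc0
  have hbd (N : ℝ) (hN : 0 < N) (x : List J) : |min (weight h x) N| ≤ N := by
    rw [abs_of_nonneg (le_min (hw x) hN.le)]
    exact min_le_right _ _
  have hsm (u : ℝ) (hu : 0 ≤ u) (N : ℝ) (hN : 0 < N) :=
    summable_mul_of_bounded (hp u hu) (hbd N hN)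
  have hMN (N : ℝ) (hN : 0 < N) : mean (μ s) (fun x => min (weight h x) N) ≤ M :=
    mean_mono (hp s hs) (hsm s hs N hN) hfin fun x => min_le_left _ _
  have hgs (u : ℝ) (hu : 0 ≤ u) (N : ℝ) (hN : 0 < N) :=
    summable_mul_of_bounded (hp u hu) (abs_gen_le hγ
      (inflow_nonneg (G := G) (hp u hu) fun j => hl.nonneg j u hu) le_rfl (hbd N hN))
  have hcrude (N : ℝ) (hN : 0 < N) (u : ℝ) (hu : u ∈ Set.Icc s t) :
      mean (μ u) (fun x => min (weight h x) N) ≤ M + |D| * (t - s) := by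
    obtain ⟨hi, he⟩ := mean_sub_mean_eq_integral hγ hl hμ (hbd N hN) hs hu.1
    have := intervalIntegral.integral_mono_on hu.1 hi (intervalIntegrable_const (c := |D|))
      fun z hz => by
        have hz0 := hs.trans hz.1
        refine mean_le_of_le (hp z hz0) (hgs z hz0 N hN) fun x => ?_
        exact (gen_truncated_weight_le hγ h1 hc0 hc
          (inflow_nonneg (hp z hz0) fun j => hl.nonneg j z hz0) hN x).2.trans
          ((hD z hz0).trans (le_abs_self D))
    rw [← he, intervalIntegral.integral_const, smul_eq_mul] at this
    have h3 := mul_le_mul_of_nonneg_right (sub_le_sub_right hu.2 s) (abs_nonneg D)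
    linarith [hMN N hN]
  set E := (t - s) * (|γ * c| * (M + |D| * (t - s))) with hE
  have hfine (N : ℝ) (hN : 0 < N) :
      mean (μ t) (fun x => min (weight h x) N) ≤ M + I + E / N := by
    obtain ⟨hi, he⟩ := mean_sub_mean_eq_integral hγ hl hμ (hbd N hN) hs hst
    have := intervalIntegral.integral_mono_on hst hi
      (hint.add (intervalIntegrable_const (c := |γ * c| * (M + |D| * (t - s)) / N)))
      fun u hu => by
        have hu0 := hs.trans hu.1
        have hv := inflow_nonneg (G := G) (hp u hu0) fun j => hl.nonneg j u hu0
        have hSb (x : List J) : |∑ r, G.rate x r * h (x.get r)| ≤ ∑ i, γ * h i := by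
          rw [← G.sum_classService_mul, abs_of_nonneg (Finset.sum_nonneg fun i _ =>
            mul_nonneg (G.classService_nonneg i x) (by linarith [h1 i]))]
          exact Finset.sum_le_sum fun i _ => mul_le_mul_of_nonneg_right
            ((G.classService_le i x).trans (hγ x)) (by linarith [h1 i])
        have hS := summable_mul_of_bounded (hp u hu0) hSb
        have hC := ((hp u hu0).2.summable.mul_right
          (∑ j, G.inflow (fun j => lam j u) (μ u) j * h j))
        have hT : Summable fun x => μ u x * (γ * c / N * min (weight h x) N) :=
          ((hsm u hu0 N hN).mul_left (γ * c / N)).congr fun x => by ring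
        have hCS := (hC.sub hS).congr (g := fun x => μ u x *
          (∑ j, G.inflow (fun j => lam j u) (μ u) j * h j - ∑ r, G.rate x r * h (x.get r)))
          fun x => by ring
        have hg := mean_mono (hp u hu0) (hgs u hu0 N hN)
          ((hCS.add hT).congr (g := fun x => μ u x *
            (∑ j, G.inflow (fun j => lam j u) (μ u) j * h j - ∑ r, G.rate x r * h (x.get r) +
              γ * c / N * min (weight h x) N)) fun x => by ring)
          fun x => ((gen_truncated_weight_le hγ h1 hc0 hc hv hN x).1.trans_eq (by ring))
        rw [mean_add hCS hT, mean_sub hC hS, mean_const (hp u hu0), mean_mul_left,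
          ← sum_outflow_mul hγ (hp u hu0), sum_inflow_mul] at hg
        have h4 : ∑ j, lam j u * h j ≤ ε * ∑ j, h j := by
          rw [Finset.mul_sum]
          exact Finset.sum_le_sum fun j _ => mul_le_mul_of_nonneg_right (hl.le j u hu0)
            (by linarith [h1 j])
        have h5 : ∑ i, G.outflow (μ u) i * ∑ j, G.routing i j * h j + mean (μ u) G.service ≤
            ∑ i, G.outflow (μ u) i * h i := by
          rw [← sum_outflow hγ (hp u hu0), ← Finset.sum_add_distrib]
          refine Finset.sum_le_sum fun i _ => ?_
          have := mul_le_mul_of_nonneg_left (hP i) (outflow_nonneg (G := G) (hp u hu0) i)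
          linarith
        have h6 : γ * c / N * mean (μ u) (fun x => min (weight h x) N) ≤
            |γ * c| * (M + |D| * (t - s)) / N := by
          have h7 := hcrude N hN u hu
          have h8 : 0 ≤ mean (μ u) (fun x => min (weight h x) N) :=
            mean_nonneg (hp u hu0) fun x => le_min (hw x) hN.le
          calc _ = γ * c * mean (μ u) (fun x => min (weight h x) N) / N := by ring
            _ ≤ |γ * c| * (M + |D| * (t - s)) / N := by
              refine div_le_div_of_nonneg_right ?_ hN.le
              exact mul_le_mul (le_abs_self _) h7 h8 (abs_nonneg _)
        refine hg.trans ?_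
        linarith
    rw [← he, intervalIntegral.integral_add hint intervalIntegrable_const,
      intervalIntegral.integral_const, smul_eq_mul] at this
    have hEN : E / N = (t - s) * (|γ * c| * (M + |D| * (t - s)) / N) := by rw [hE]; ring
    linarith [hMN N hN]
  have hpart (S : Finset (List J)) : ∑ x ∈ S, μ t x * weight h x ≤ M + I := by
    have hlim : Filter.Tendsto (fun N : ℝ => M + I + E / N) Filter.atTop (nhds (M + I)) := by
      simpa using (tendsto_const_nhds (x := M + I)).add
        (tendsto_const_nhds (x := E) |>.div_atTop Filter.tendsto_id)
    refine ge_of_tendsto hlim ?_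
    filter_upwards [Filter.eventually_gt_atTop 0,
      Filter.eventually_ge_atTop (∑ x ∈ S, weight h x)] with N hN hN'
    refine le_trans ?_ (hfine N hN)
    refine le_trans (Finset.sum_le_sum fun x hx => ?_) ((hsm t ht N hN).sum_le_tsum S fun x _ =>
      mul_nonneg ((hp t ht).1 x) (le_min (hw x) hN.le))
    beta_reduce
    rw [min_eq_left ((Finset.single_le_sum (fun y _ => hw y) hx).trans hN')]
  have hnn (x : List J) : 0 ≤ μ t x * weight h x := mul_nonneg ((hp t ht).1 x) (hw x)
  exact ⟨summable_of_sum_le hnn hpart, Real.tsum_le_of_sum_le hnn hpart⟩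

end

/-! ### The envelope and the backward test function -/

noncomputable section

/-- A function whose increments are at most quadratic in the step does not increase. -/
lemma le_of_increments_le_sq {g : ℝ → ℝ} {t K η : ℝ} (ht : 0 ≤ t) (hη : 0 < η)
    (hg : ∀ s s', 0 ≤ s → s ≤ s' → s' ≤ t → s' - s ≤ η → g s' ≤ g s + K * (s' - s) ^ 2) :
    g t ≤ g 0 := by
  have hlim : Filter.Tendsto (fun n : ℕ => g 0 + K * t ^ 2 / (n : ℝ)) Filter.atTop
      (nhds (g 0)) := by
    simpa using (tendsto_const_nhds (x := g 0)).add
      (tendsto_const_div_atTop_nhds_zero_nat (K * t ^ 2))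
  refine ge_of_tendsto hlim ?_
  obtain ⟨m, hm⟩ := exists_nat_ge (t / η)
  filter_upwards [Filter.eventually_ge_atTop (m + 1)] with n hn
  have hn0 : (0 : ℝ) < n := by
    have : 0 < n := by omega
    exact_mod_cast this
  have hstep : t / n ≤ η := by
    rw [div_le_iff₀ hn0]
    have h1 : (m : ℝ) ≤ n := by exact_mod_cast (Nat.le_succ m).trans hn
    rw [div_le_iff₀ hη] at hm
    nlinarith
  have hk (k : ℕ) (hkn : k ≤ n) : g (k * (t / n)) ≤ g 0 + k * (K * (t / n) ^ 2) := by
    induction k with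
    | zero => simp
    | succ k ih =>
      have hkn' : ((k + 1 : ℕ) : ℝ) ≤ n := by exact_mod_cast hkn
      have htn : 0 ≤ t / n := div_nonneg ht hn0.le
      have e : ((k + 1 : ℕ) : ℝ) * (t / n) - k * (t / n) = t / n := by push_cast; ring
      have := hg (k * (t / n)) ((k + 1 : ℕ) * (t / n)) (by positivity) (by linarith)
        (by calc ((k + 1 : ℕ) : ℝ) * (t / n) ≤ n * (t / n) := by gcongr
              _ = t := mul_div_cancel₀ t hn0.ne') (by rw [e]; exact hstep)
      rw [e] at this
      have := ih (by omega)
      push_cast at *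
      linarith
  have := hk n le_rfl
  rw [mul_div_cancel₀ t hn0.ne'] at this
  refine this.trans_eq ?_
  field_simp

/-- The Euler step of the birth-death chain on `ℕ` with death probability `p` and birth
probability `q`. -/
def eulerStep (p q : ℝ) (F : ℕ → ℝ) (n : ℕ) : ℝ :=
  F n + p * (F (n - 1) - F n) + q * (F (n + 1) - F n)

lemma eulerStep_mono {p q : ℝ} (hp : 0 ≤ p) (hq : 0 ≤ q) (hpq : p + q ≤ 1) {F F' : ℕ → ℝ}
    (h : ∀ n, F n ≤ F' n) (n : ℕ) : eulerStep p q F n ≤ eulerStep p q F' n := by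
  have e (F : ℕ → ℝ) : eulerStep p q F n = (1 - (p + q)) * F n + p * F (n - 1) + q * F (n + 1) := by
    unfold eulerStep; ring
  rw [e, e]
  have := mul_le_mul_of_nonneg_left (h n) (sub_nonneg.2 hpq)
  have := mul_le_mul_of_nonneg_left (h (n - 1)) hp
  have := mul_le_mul_of_nonneg_left (h (n + 1)) hq
  linarith

section Envelope

variable {a : ℝ} {V : ℝ → ℝ}

/-- The mean number of arrivals up to time `t`, at the rate `V`. -/
def cumulative (V : ℝ → ℝ) (t : ℝ) : ℝ := ∫ u in (0 : ℝ)..t, V u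

/-- The solution of `R' = -a (R - 1) + V R`, `R(0) = 1`: the bound for the mean of `2 ^ L` for the
length `L` of a queue that is initially empty, with arrival rate `V` and service rate `2 * a`. -/
def envelope (a : ℝ) (V : ℝ → ℝ) (t : ℝ) : ℝ :=
  Real.exp (cumulative V t - a * t) *
    (1 + a * ∫ u in (0 : ℝ)..t, Real.exp (a * u - cumulative V u))

variable (hV0 : ∀ u, 0 ≤ u → 0 ≤ V u)
  (hint : ∀ s t, 0 ≤ s → s ≤ t → IntervalIntegrable V MeasureTheory.volume s t)

include hint in
lemma cumulative_sub {s t : ℝ} (hs : 0 ≤ s) (hst : s ≤ t) :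
    cumulative V t - cumulative V s = ∫ u in s..t, V u :=
  intervalIntegral.integral_interval_sub_left (hint 0 t le_rfl (hs.trans hst))
    (hint 0 s le_rfl hs)

include hV0 hint in
lemma cumulative_mono {s t : ℝ} (hs : 0 ≤ s) (hst : s ≤ t) :
    cumulative V s ≤ cumulative V t := by
  rw [← sub_nonneg, cumulative_sub hint hs hst]
  exact intervalIntegral.integral_nonneg hst fun u hu => hV0 u (hs.trans hu.1)

include hint in
lemma continuousOn_cumulative : ContinuousOn (cumulative V) (Set.Ici 0) := by
  intro t ht
  have ht0 : (0 : ℝ) ≤ t := ht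
  have h1 := hint 0 (t + 1) le_rfl (by linarith)
  rw [intervalIntegrable_iff_integrableOn_Icc_of_le (by linarith),
    ← Set.uIcc_of_le (by linarith)] at h1
  have h2 := intervalIntegral.continuousOn_primitive_interval h1
  rw [Set.uIcc_of_le (by linarith)] at h2
  refine (h2 t ⟨ht0, by linarith⟩).mono_of_mem_nhdsWithin ?_
  rw [← Set.Ici_inter_Iic]
  exact Filter.inter_mem self_mem_nhdsWithin
    (mem_nhdsWithin_of_mem_nhds (Iic_mem_nhds (by linarith)))

include hint in
lemma continuousOn_exp_sub_cumulative (a : ℝ) :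
    ContinuousOn (fun u => Real.exp (a * u - cumulative V u)) (Set.Ici 0) :=
  ((continuousOn_const.mul continuousOn_id).sub (continuousOn_cumulative hint)).rexp

include hint in
lemma intervalIntegrable_exp_sub_cumulative (a : ℝ) {s t : ℝ} (hs : 0 ≤ s) (hst : s ≤ t) :
    IntervalIntegrable (fun u => Real.exp (a * u - cumulative V u)) MeasureTheory.volume s t := by
  refine ((continuousOn_exp_sub_cumulative hint a).mono fun u hu => ?_).intervalIntegrable
  rw [Set.uIcc_of_le hst] at hu
  exact hs.trans hu.1

include hV0 hint in
lemma one_le_envelope (ha : 0 < a) {t : ℝ} (ht : 0 ≤ t) : 1 ≤ envelope a V t := by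
  have h1 : ∫ u in (0 : ℝ)..t, Real.exp (a * u) * Real.exp (-cumulative V t) ≤
      ∫ u in (0 : ℝ)..t, Real.exp (a * u - cumulative V u) := by
    refine intervalIntegral.integral_mono_on ht
      (Continuous.intervalIntegrable (by fun_prop) _ _)
      (intervalIntegrable_exp_sub_cumulative hint a le_rfl ht) fun u hu => ?_
    rw [← Real.exp_add]
    exact Real.exp_le_exp.2 (by linarith [cumulative_mono hV0 hint hu.1 hu.2])
  have h2 : ∫ u in (0 : ℝ)..t, Real.exp (a * u) = (Real.exp (a * t) - 1) / a := by
    rw [intervalIntegral.integral_comp_mul_left _ ha.ne']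
    simp [integral_exp, div_eq_inv_mul]
  rw [intervalIntegral.integral_mul_const, h2] at h1
  have h3 : Real.exp (cumulative V t - a * t) * (1 + a * ((Real.exp (a * t) - 1) / a *
      Real.exp (-cumulative V t))) ≤ envelope a V t := by
    unfold envelope
    gcongr
  refine le_trans ?_ h3
  have h4 : Real.exp (cumulative V t - a * t) * (1 + a * ((Real.exp (a * t) - 1) / a *
      Real.exp (-cumulative V t))) =
      1 + (Real.exp (cumulative V t) - 1) * Real.exp (-(a * t)) := by
    rw [Real.exp_sub, Real.exp_neg, Real.exp_neg]
    field_simp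
    ring
  rw [h4]
  have h5 : 1 ≤ Real.exp (cumulative V t) := Real.one_le_exp (by
    simpa [cumulative] using cumulative_mono hV0 hint le_rfl ht)
  have := mul_nonneg (sub_nonneg.2 h5) (Real.exp_pos (-(a * t))).le
  linarith

/-- The test function of the comparison, with the terminal time `t`: the mean length at time `t`,
truncated at `N`, given the length `n` at time `s`, is at most each of the three terms. The first
one is an exponential moment, the second one disregards services, and `N` makes the function
bounded. Each of them is a supersolution of the backward equation, hence so is the minimum. -/
def lengthBound (a : ℝ) (V : ℝ → ℝ) (N t s : ℝ) (n : ℕ) : ℝ :=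
  min (min (Real.exp (cumulative V t - a * t) * (Real.exp (a * s - cumulative V s) * 2 ^ n +
    a * ∫ u in s..t, Real.exp (a * u - cumulative V u)) - 1)
    (n + (cumulative V t - cumulative V s))) N

lemma monotone_lengthBound (N t s : ℝ) : Monotone (lengthBound a V N t s) := by
  intro m n hmn
  unfold lengthBound
  gcongr
  norm_num

include hV0 hint in
lemma abs_lengthBound_le (ha : 0 < a) {N t s : ℝ} (hN : 1 ≤ N) (hs : 0 ≤ s) (hst : s ≤ t) (n : ℕ) :
    |lengthBound a V N t s n| ≤ N := by
  have h1 : 0 ≤ ∫ u in s..t, Real.exp (a * u - cumulative V u) :=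
    intervalIntegral.integral_nonneg hst fun _ _ => (Real.exp_pos _).le
  have h2 := cumulative_mono hV0 hint hs hst
  refine abs_le.2 ⟨?_, min_le_right _ _⟩
  refine le_min (le_min ?_ ?_) (by linarith)
  · have : 0 ≤ Real.exp (cumulative V t - a * t) * (Real.exp (a * s - cumulative V s) * 2 ^ n +
      a * ∫ u in s..t, Real.exp (a * u - cumulative V u)) := by positivity
    linarith
  · have : (0 : ℝ) ≤ n := Nat.cast_nonneg n
    linarith

include hV0 hint in
/-- The test function is a supersolution of the backward equation, up to an error quadratic in the
time step. -/
lemma eulerStep_lengthBound_le (ha : 0 < a) {N t s s' : ℝ} (hs : 0 ≤ s) (hss' : s ≤ s')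
    (hst : s' ≤ t) (hsmall : 2 * a * (s' - s) + ∫ u in s..s', V u ≤ 1) (n : ℕ) :
    eulerStep (2 * a * (s' - s)) (∫ u in s..s', V u) (lengthBound a V N t s') n ≤
      lengthBound a V N t s n + a ^ 2 * Real.exp (cumulative V t) * (s' - s) ^ 2 := by
  set p := 2 * a * (s' - s) with hp
  set q := ∫ u in s..s', V u with hq
  set φ : ℝ → ℝ := fun u => Real.exp (a * u - cumulative V u) with hφ
  set c := Real.exp (cumulative V t - a * t) with hc
  have hs' : 0 ≤ s' := hs.trans hss'
  have hqw : cumulative V s' - cumulative V s = q := cumulative_sub hint hs hss'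
  have hp0 : 0 ≤ p := by have := sub_nonneg.2 hss'; positivity
  have hq0 : 0 ≤ q := by rw [← hqw]; exact sub_nonneg.2 (cumulative_mono hV0 hint hs hss')
  have hc0 : 0 < c := Real.exp_pos _
  have hφ0 (u : ℝ) : 0 < φ u := Real.exp_pos _
  have herr : 0 ≤ a ^ 2 * Real.exp (cumulative V t) * (s' - s) ^ 2 := by positivity
  have hcφ : c * φ s' ≤ Real.exp (cumulative V t) := by
    rw [hc, hφ, ← Real.exp_add]
    refine Real.exp_le_exp.2 ?_
    have h1 : 0 ≤ cumulative V s' := by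
      simpa [cumulative] using cumulative_mono hV0 hint le_rfl hs'
    nlinarith
  -- The exponential is at least its linearization.
  have hφs : φ s' * (1 - p / 2 + q) ≤ φ s := by
    have e : φ s = φ s' * Real.exp (-(p / 2) + q) := by
      simp only [hφ]; rw [← Real.exp_add, ← hqw, hp]; congr 1; ring
    rw [e]
    refine mul_le_mul_of_nonneg_left ?_ (hφ0 _).le
    linarith [Real.add_one_le_exp (-(p / 2) + q)]
  have hIadd : ∫ u in s..t, φ u = (∫ u in s..s', φ u) + ∫ u in s'..t, φ u :=
    (intervalIntegral.integral_add_adjacent_intervals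
      (intervalIntegrable_exp_sub_cumulative hint a hs hss')
      (intervalIntegrable_exp_sub_cumulative hint a hs' hst)).symm
  have hI : φ s' * (1 - p / 2) * (s' - s) ≤ ∫ u in s..s', φ u := by
    have := intervalIntegral.integral_mono_on hss'
      (intervalIntegrable_const (c := φ s' * (1 - p / 2)))
      (intervalIntegrable_exp_sub_cumulative hint a hs hss') fun u hu => by
        have e : φ u = φ s' * Real.exp (-(a * (s' - u)) + (cumulative V s' - cumulative V u)) := by
          simp only [hφ]; rw [← Real.exp_add]; congr 1; ring
        change _ ≤ φ u
        rw [e]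
        refine mul_le_mul_of_nonneg_left ?_ (hφ0 _).le
        have h1 := Real.add_one_le_exp (-(a * (s' - u)) + (cumulative V s' - cumulative V u))
        have h2 := cumulative_mono hV0 hint (hs.trans hu.1) hu.2
        have h3 : a * (s' - u) ≤ p / 2 := by rw [hp]; nlinarith [hu.1]
        linarith
    rwa [intervalIntegral.integral_const, smul_eq_mul, mul_comm] at this
  have hI0 : 0 ≤ ∫ u in s..s', φ u :=
    intervalIntegral.integral_nonneg hss' fun _ _ => (hφ0 _).le
  have mono := fun {F' : ℕ → ℝ} (h : ∀ m, lengthBound a V N t s' m ≤ F' m) =>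
    eulerStep_mono hp0 hq0 hsmall h n
  rw [← sub_le_iff_le_add]
  refine le_min (le_min ?_ ?_) ?_ <;> rw [sub_le_iff_le_add]
  · refine (mono fun m => (min_le_left _ _).trans (min_le_left _ _)).trans ?_
    change eulerStep p q (fun m => c * (φ s' * 2 ^ m + a * ∫ u in s'..t, φ u) - 1) n ≤
      c * (φ s * 2 ^ n + a * ∫ u in s..t, φ u) - 1 + _
    rw [hIadd]
    unfold eulerStep
    cases n with
    | zero =>
      have h1 := mul_le_mul_of_nonneg_left hφs hc0.le
      have h2 := mul_le_mul_of_nonneg_left hI (mul_nonneg hc0.le ha.le)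
      have h3 := mul_le_mul_of_nonneg_right hcφ (mul_nonneg (sq_nonneg a) (sq_nonneg (s' - s)))
      simp only [pow_zero, zero_add, pow_one, Nat.zero_sub]
      rw [hp] at h1 h2 ⊢
      nlinarith
    | succ n =>
      have h1 := mul_le_mul_of_nonneg_left hφs (mul_nonneg hc0.le (pow_nonneg zero_le_two (n + 1)))
      have h2 := mul_nonneg (mul_nonneg hc0.le ha.le) hI0
      simp only [Nat.add_sub_cancel, pow_succ] at h1 ⊢
      nlinarith
  · refine (mono fun m => (min_le_left _ _).trans (min_le_right _ _)).trans ?_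
    unfold eulerStep
    have h1 : ((n - 1 : ℕ) : ℝ) ≤ n := by exact_mod_cast Nat.sub_le n 1
    push_cast
    nlinarith
  · refine (mono fun m => min_le_right _ _).trans ?_
    simp only [eulerStep, sub_self, mul_zero, add_zero]
    linarith

end Envelope

end

/-! ### The comparison of the mean length with the envelope -/

noncomputable section

section Envelope

variable {a : ℝ} {V : ℝ → ℝ}
  (hV0 : ∀ u, 0 ≤ u → 0 ≤ V u)
  (hint : ∀ s t, 0 ≤ s → s ≤ t → IntervalIntegrable V MeasureTheory.volume s t)

include hint in
lemma continuousOn_integral_exp (a : ℝ) : ContinuousOn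
    (fun t => ∫ u in (0 : ℝ)..t, Real.exp (a * u - cumulative V u)) (Set.Ici 0) :=
  continuousOn_cumulative (V := fun u => Real.exp (a * u - cumulative V u))
    fun _ _ hs hst => intervalIntegrable_exp_sub_cumulative hint a hs hst

include hint in
lemma continuousOn_envelope (a : ℝ) : ContinuousOn (envelope a V) (Set.Ici 0) :=
  ((continuousOn_cumulative hint).sub (continuousOn_const.mul continuousOn_id)).rexp.mul
    (continuousOn_const.add (continuousOn_const.mul (continuousOn_integral_exp hint a)))

lemma envelope_zero : envelope a V 0 = 1 := by simp [envelope, cumulative]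

include hV0 hint in
lemma intervalIntegrable_envelope_inv (ha : 0 < a) {s t : ℝ} (hs : 0 ≤ s) (hst : s ≤ t) :
    IntervalIntegrable (fun u => a * (1 - (envelope a V u)⁻¹)) MeasureTheory.volume s t := by
  have hsub : Set.uIcc s t ⊆ Set.Ici 0 := fun u hu => by
    rw [Set.uIcc_of_le hst] at hu
    exact hs.trans hu.1
  refine ContinuousOn.intervalIntegrable ?_
  refine continuousOn_const.mul (continuousOn_const.sub
    (((continuousOn_envelope hint a).mono hsub).inv₀ fun u hu => ?_))
  linarith [one_le_envelope hV0 hint ha (hsub hu)]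

include hV0 hint in
/-- The logarithmic form of the differential equation of the envelope. Only the part of
`log R` that is not `cumulative V` is differentiable everywhere. -/
lemma log_envelope_sub (ha : 0 < a) {s t : ℝ} (hs : 0 ≤ s) (hst : s ≤ t) :
    Real.log (envelope a V t) - Real.log (envelope a V s) =
      (∫ u in s..t, V u) - ∫ u in s..t, a * (1 - (envelope a V u)⁻¹) := by
  set φ : ℝ → ℝ := fun u => Real.exp (a * u - cumulative V u) with hφ
  set Φ : ℝ → ℝ := fun t => ∫ u in (0 : ℝ)..t, φ u with hΦ
  have hΦ0 (u : ℝ) (hu : 0 ≤ u) : 0 < 1 + a * Φ u := by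
    have : 0 ≤ Φ u := intervalIntegral.integral_nonneg hu fun _ _ => (Real.exp_pos _).le
    positivity
  have hlog (u : ℝ) (hu : 0 ≤ u) : Real.log (envelope a V u) =
      cumulative V u + (Real.log (1 + a * Φ u) - a * u) := by
    change Real.log (Real.exp (cumulative V u - a * u) * (1 + a * Φ u)) = _
    rw [Real.log_mul (Real.exp_pos _).ne' (hΦ0 u hu).ne', Real.log_exp]
    ring
  have hinv (u : ℝ) : a * φ u / (1 + a * Φ u) = a * (envelope a V u)⁻¹ := by
    change _ = a * (Real.exp (cumulative V u - a * u) * (1 + a * Φ u))⁻¹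
    rw [mul_inv, ← Real.exp_neg, neg_sub]
    simp only [hφ]
    ring
  have hsub : Set.Icc s t ⊆ Set.Ici 0 := fun u hu => hs.trans hu.1
  have hφc := continuousOn_exp_sub_cumulative hint a
  have hΦc : ContinuousOn Φ (Set.Ici 0) := continuousOn_integral_exp hint a
  have hder : ∀ u ∈ Set.Ioo s t,
      HasDerivAt (fun u => Real.log (1 + a * Φ u) - a * u) (-(a * (1 - (envelope a V u)⁻¹))) u := by
    intro u hu
    have hu0 : 0 < u := hs.trans_lt hu.1
    have h1 : HasDerivAt Φ (φ u) u := by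
      refine intervalIntegral.integral_hasDerivAt_right
        (intervalIntegrable_exp_sub_cumulative hint a le_rfl hu0.le) ?_
        (hφc.continuousAt (Ici_mem_nhds hu0))
      exact hφc.mono Set.Ioi_subset_Ici_self |>.stronglyMeasurableAtFilter isOpen_Ioi u hu0
    have h2 := ((h1.const_mul a).const_add 1).log (hΦ0 u hu0.le).ne'
    rw [hinv] at h2
    exact (h2.sub ((hasDerivAt_id u).const_mul a)).congr_deriv (by ring)
  have hcont : ContinuousOn (fun u => Real.log (1 + a * Φ u) - a * u) (Set.Icc s t) :=
    ((continuousOn_const.add (continuousOn_const.mul (hΦc.mono hsub))).log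
      fun u hu => (hΦ0 u (hsub hu)).ne').sub (continuousOn_const.mul continuousOn_id)
  have hftc := intervalIntegral.integral_eq_sub_of_hasDerivAt_of_le hst hcont hder
    (intervalIntegrable_envelope_inv hV0 hint ha hs hst).neg
  rw [intervalIntegral.integral_neg] at hftc
  rw [hlog t (hs.trans hst), hlog s hs, ← cumulative_sub hint hs hst]
  linarith

end Envelope

/-- The part of the bound for the mean length that stems from the queues that have not been empty
tends to zero when the arrivals are slower than the services: short queues are controlled by the
exponential, and long ones by the finite mean of the initial length. -/
lemma tendsto_mean_min_zero {J : Type*} {a : ℝ} {μ₀ : List J → ℝ} (hμ₀ : μ₀ ∈ probMeasures J)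
    (hfin : Summable fun x => μ₀ x * (x.length : ℝ)) (ha : 0 < a) {M : ℝ} (hM : 0 ≤ M) :
    Filter.Tendsto (fun t : ℝ => mean μ₀ fun x => min
      (2 ^ x.length * Real.exp (M + a / 4 * t - a * t)) (x.length + (M + a / 4 * t)))
      Filter.atTop (nhds 0) := by
  have hbound : Summable fun x => μ₀ x * (Real.exp M + 2 * x.length + M) := by
    refine (((hμ₀.2.summable.mul_right (Real.exp M)).add (hfin.mul_left 2)).add
      (hμ₀.2.summable.mul_right M)).congr fun x => by ring
  have hterm (x : List J) : Filter.Tendsto (fun t : ℝ => μ₀ x * min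
      (2 ^ x.length * Real.exp (M + a / 4 * t - a * t)) (x.length + (M + a / 4 * t)))
      Filter.atTop (nhds (0 : ℝ)) := by
    have h1 : Filter.Tendsto (fun t : ℝ => M + a / 4 * t - a * t) Filter.atTop Filter.atBot := by
      have : (fun t : ℝ => M + a / 4 * t - a * t) = fun t => M + (-(3 * a / 4)) * t := by
        ext t; ring
      rw [this]
      exact Filter.tendsto_atBot_add_const_left _ _
        (Filter.Tendsto.const_mul_atTop_of_neg (by linarith) Filter.tendsto_id)
    have h2 := (Real.tendsto_exp_atBot.comp h1).const_mul ((2 : ℝ) ^ x.length)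
    rw [mul_zero] at h2
    have h3 : Filter.Tendsto (fun t : ℝ => min
        (2 ^ x.length * Real.exp (M + a / 4 * t - a * t)) (x.length + (M + a / 4 * t)))
        Filter.atTop (nhds (0 : ℝ)) := by
      refine tendsto_of_tendsto_of_tendsto_of_le_of_le' tendsto_const_nhds h2 ?_
        (.of_forall fun t => min_le_left _ _)
      filter_upwards [Filter.eventually_ge_atTop 0] with t ht
      exact le_min (by positivity) (by positivity)
    simpa using h3.const_mul (μ₀ x)
  have := tendsto_tsum_of_dominated_convergence hbound hterm ?_
  · simpa only [tsum_zero] using! this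
  filter_upwards [Filter.eventually_ge_atTop 0] with t ht x
  have h0 : 0 ≤ min (2 ^ x.length * Real.exp (M + a / 4 * t - a * t))
      (x.length + (M + a / 4 * t)) := le_min (by positivity) (by positivity)
  rw [Real.norm_eq_abs, abs_of_nonneg (mul_nonneg (hμ₀.1 x) h0)]
  refine mul_le_mul_of_nonneg_left ?_ (hμ₀.1 x)
  have hn : (0 : ℝ) ≤ x.length := Nat.cast_nonneg _
  rcases le_total (x.length : ℝ) (a / 4 * t) with hx | hx
  · refine (min_le_left _ _).trans ?_
    have h2 : (2 : ℝ) ^ x.length ≤ Real.exp x.length := by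
      rw [← Real.exp_one_pow]
      exact pow_le_pow_left₀ zero_le_two (by linarith [Real.add_one_le_exp 1]) _
    have h3 : Real.exp x.length * Real.exp (M + a / 4 * t - a * t) ≤ Real.exp M := by
      rw [← Real.exp_add]
      exact Real.exp_le_exp.2 (by nlinarith)
    have h4 := mul_le_mul_of_nonneg_right h2 (Real.exp_pos (M + a / 4 * t - a * t)).le
    linarith
  · refine (min_le_right _ _).trans ?_
    linarith [Real.exp_pos M]

variable {J : Type*} [Fintype J] [DecidableEq J] {G : Network J}
  {γ a ε : ℝ} {lam : J → ℝ → ℝ} {μ : ℝ → List J → ℝ}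

/-- The mean length at time `t` is at most the sum of a part for the queues that have been empty
before, and of a part for the queues that have not. -/
lemma mean_length_le_envelope (hγ : ∀ x, G.service x ≤ γ) (ha : 0 < a)
    (hγm : ∀ x : List J, x ≠ [] → 2 * a ≤ G.service x) (hl : IsExternalInflow lam ε)
    (hμ : G.IsNLMP lam μ) (hfin : Summable fun x => μ 0 x * (x.length : ℝ)) {t : ℝ} (ht : 0 ≤ t) :
    mean (μ t) (fun x => (x.length : ℝ)) ≤ envelope a (G.arrivals lam μ) t - 1 +
      mean (μ 0) (fun x => min
        (2 ^ x.length * Real.exp (cumulative (G.arrivals lam μ) t - a * t))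
        (x.length + cumulative (G.arrivals lam μ) t)) := by
  set V := G.arrivals lam μ with hV
  set B := Fintype.card J * ε + γ with hB
  have hV0 : ∀ u, 0 ≤ u → 0 ≤ V u := fun u hu => arrivals_nonneg hl hμ hu
  have hint : ∀ s t, 0 ≤ s → s ≤ t → IntervalIntegrable V MeasureTheory.volume s t :=
    fun s t hs hst => intervalIntegrable_arrivals hγ hl hμ hs hst
  have hB0 : 0 ≤ B := (hV0 0 le_rfl).trans (arrivals_le hγ hl hμ le_rfl)
  have hp (u : ℝ) (hu : 0 ≤ u) := hμ.mem_probMeasures u hu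
  have hw0 : 0 ≤ cumulative V t := by
    simpa [cumulative] using cumulative_mono hV0 hint le_rfl ht
  have hR := one_le_envelope hV0 hint ha ht
  have hbd (N : ℝ) (hN : 1 ≤ N) (s : ℝ) (hs : 0 ≤ s) (hst : s ≤ t) :=
    abs_lengthBound_le (a := a) (N := N) hV0 hint ha hN hs hst
  have hdec (N : ℝ) (hN : 1 ≤ N) :
      mean (μ t) (fun x => lengthBound a V N t t x.length) ≤
        mean (μ 0) (fun x => lengthBound a V N t 0 x.length) := by
    refine le_of_increments_le_sq (g := fun s => mean (μ s) fun x => lengthBound a V N t s x.length)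
      (η := (2 * a + B)⁻¹)
      (K := a ^ 2 * Real.exp (cumulative V t) + (2 * a + B) * (2 * (γ + B) * (2 * N)))
      ht (by positivity) ?_
    intro s s' hs hss' hst hη
    have hs' := hs.trans hss'
    have hq : ∫ u in s..s', V u ≤ B * (s' - s) := by
      have := intervalIntegral.integral_mono_on hss' (hint s s' hs hss')
        (intervalIntegrable_const (c := B)) fun u hu => arrivals_le hγ hl hμ (hs.trans hu.1)
      rwa [intervalIntegral.integral_const, smul_eq_mul, mul_comm] at this
    have hsmall : 2 * a * (s' - s) + ∫ u in s..s', V u ≤ 1 := by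
      have h1 : (2 * a + B) * (s' - s) ≤ 1 := by
        calc (2 * a + B) * (s' - s) ≤ (2 * a + B) * (2 * a + B)⁻¹ := by gcongr
          _ = 1 := mul_inv_cancel₀ (by positivity)
      linarith
    have h1 := mean_length_le hγ (by positivity) hγm hl hμ (monotone_lengthBound N t s')
      (hbd N hN s' hs' hst) hs hss'
    have hq0 : 0 ≤ ∫ u in s..s', V u :=
      intervalIntegral.integral_nonneg hss' fun u hu => hV0 u (hs.trans hu.1)
    have hp0 : 0 ≤ 2 * a * (s' - s) := by have := sub_nonneg.2 hss'; positivity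
    have hconst : Summable fun x => μ s x *
        (a ^ 2 * Real.exp (cumulative V t) * (s' - s) ^ 2) := (hp s hs).2.summable.mul_right _
    have hbs : Summable fun x => μ s x * lengthBound a V N t s x.length :=
      summable_mul_of_bounded (hp s hs) fun x => hbd N hN s hs (hss'.trans hst) _
    have h2 : mean (μ s) (fun x => eulerStep (2 * a * (s' - s)) (∫ u in s..s', V u)
        (lengthBound a V N t s') x.length) ≤ mean (μ s) (fun x => lengthBound a V N t s x.length
          + a ^ 2 * Real.exp (cumulative V t) * (s' - s) ^ 2) := by
      refine mean_mono (hp s hs) (summable_mul_of_bounded (hp s hs) (N := N) fun x => ?_)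
        ((hbs.add hconst).congr fun x => by ring)
        fun x => eulerStep_lengthBound_le hV0 hint ha hs hss' hst hsmall _
      have e (c : ℝ) : eulerStep (2 * a * (s' - s)) (∫ u in s..s', V u) (fun _ => c) x.length = c := by
        simp [eulerStep]
      refine abs_le.2 ⟨?_, ?_⟩
      · conv_lhs => rw [← e (-N)]
        exact eulerStep_mono hp0 hq0 hsmall (fun n => (abs_le.1 (hbd N hN s' hs' hst n)).1) _
      · conv_rhs => rw [← e N]
        exact eulerStep_mono hp0 hq0 hsmall (fun n => (abs_le.1 (hbd N hN s' hs' hst n)).2) _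
    rw [mean_add hbs hconst, mean_const (hp s hs)] at h2
    have h3 := h1.trans (add_le_add_left h2 _)
    refine h3.trans_eq ?_
    ring
  set f : List J → ℝ := fun x => min
    (2 ^ x.length * Real.exp (cumulative V t - a * t)) (x.length + cumulative V t) with hf
  have hf0 (x : List J) : 0 ≤ f x := le_min (by positivity) (by positivity)
  have hfs : Summable fun x => μ 0 x * f x := by
    refine Summable.of_nonneg_of_le (fun x => mul_nonneg ((hp 0 le_rfl).1 x) (hf0 x))
      (fun x => mul_le_mul_of_nonneg_left (min_le_right _ _) ((hp 0 le_rfl).1 x)) ?_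
    exact (hfin.add ((hp 0 le_rfl).2.summable.mul_right (cumulative V t))).congr
      fun x => by ring
  have hinit (N : ℝ) (hN : 1 ≤ N) : mean (μ 0) (fun x => lengthBound a V N t 0 x.length) ≤
      envelope a V t - 1 + mean (μ 0) f := by
    have hc := (hp 0 le_rfl).2.summable.mul_right (envelope a V t - 1)
    rw [← mean_const (hp 0 le_rfl) (envelope a V t - 1), ← mean_add hc hfs]
    refine mean_mono (hp 0 le_rfl) (summable_mul_of_bounded (hp 0 le_rfl) fun x =>
      hbd N hN 0 le_rfl ht _) ((hc.add hfs).congr fun x => by ring) fun x => ?_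
    refine (min_le_left _ _).trans ?_
    have hz : cumulative V 0 = 0 := by simp [cumulative]
    rw [← sub_le_iff_le_add']
    refine le_min ?_ ?_ <;> rw [sub_le_iff_le_add']
    · refine (min_le_left _ _).trans ?_
      have := Real.exp_pos (cumulative V t - a * t)
      rw [hz, envelope, mul_zero, sub_zero, Real.exp_zero]
      nlinarith
    · refine (min_le_right _ _).trans ?_
      rw [hz]
      linarith
  have hpart (S : Finset (List J)) : ∑ x ∈ S, μ t x * (x.length : ℝ) ≤
      envelope a V t - 1 + mean (μ 0) f := by
    set N : ℝ := 1 + ∑ x ∈ S, (x.length : ℝ) with hN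
    have hN1 : 1 ≤ N := by
      have : 0 ≤ ∑ x ∈ S, (x.length : ℝ) := Finset.sum_nonneg fun _ _ => Nat.cast_nonneg _
      linarith
    have hval (n : ℕ) : lengthBound a V N t t n = min (min (2 ^ n - 1) (n : ℝ)) N := by
      unfold lengthBound
      rw [intervalIntegral.integral_same, mul_zero, add_zero, sub_self, add_zero, ← mul_assoc,
        ← Real.exp_add]
      simp
    have hval' (n : ℕ) : lengthBound a V N t t n = min (n : ℝ) N := by
      have : (n : ℝ) + 1 ≤ 2 ^ n := by exact_mod_cast Nat.lt_two_pow_self (n := n)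
      rw [hval, min_eq_right (by linarith : (n : ℝ) ≤ 2 ^ n - 1)]
    refine le_trans ?_ ((hdec N hN1).trans (hinit N hN1))
    refine le_trans (Finset.sum_le_sum fun x hx => ?_) ((summable_mul_of_bounded (hp t ht)
      fun x => hbd N hN1 t ht le_rfl x.length).sum_le_tsum S fun x _ =>
        mul_nonneg ((hp t ht).1 x) ?_)
    · beta_reduce
      rw [hval', min_eq_left]
      have := Finset.single_le_sum (f := fun x : List J => (x.length : ℝ))
        (fun y _ => Nat.cast_nonneg _) hx
      linarith
    · beta_reduce
      rw [hval']
      exact le_min (Nat.cast_nonneg _) (by linarith)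
  exact Real.tsum_le_of_sum_le
    (fun x => mul_nonneg ((hp t ht).1 x) (Nat.cast_nonneg _)) hpart

end

/-! ### The Lyapunov function -/

lemma nonemptyFraction_le_one {J : Type*} {μ : List J → ℝ} (hμ : μ ∈ probMeasures J) :
    nonemptyFraction μ ≤ 1 := by
  have := hμ.1 []
  unfold nonemptyFraction
  linarith

lemma nonemptyFraction_le_mean {J : Type*} [DecidableEq J] {μ F : List J → ℝ} (hμ : μ ∈ probMeasures J)
    (hF : ∀ x, x ≠ [] → 1 ≤ F x) (hF0 : 0 ≤ F []) (hs : Summable fun x => μ x * F x) :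
    nonemptyFraction μ ≤ mean μ F := by
  have h := (hμ.2.summable.sub (hasSum_pointMass_mul μ []).summable).tsum_le_tsum
    (g := fun x => μ x * F x) (fun x => ?_) hs
  · rw [hμ.2.summable.tsum_sub (hasSum_pointMass_mul μ []).summable, hμ.2.tsum_eq,
      (hasSum_pointMass_mul μ []).tsum_eq] at h
    exact h
  · by_cases hx : x = []
    · subst hx
      simpa [pointMass] using mul_nonneg (hμ.1 []) hF0
    · simpa [pointMass, hx] using le_mul_of_one_le_right (hμ.1 x) (hF x hx)

/-- The logarithm of the envelope plus the mean weight: the terms with the service rate cancel,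
so that external arrivals only are left, against the relaxation of the envelope. -/
lemma lyapunov_le {J : Type*} [Fintype J] [DecidableEq J] {G : Network J} {γ a ε c : ℝ}
    {lam : J → ℝ → ℝ} {μ : ℝ → List J → ℝ} {h : J → ℝ}
    (hγ : ∀ x, G.service x ≤ γ) (ha : 0 < a) (hl : IsExternalInflow lam ε)
    (hμ : G.IsNLMP lam μ) (h1 : ∀ j, 1 ≤ h j) (hc : ∑ j, h j = c)
    (hP : ∀ i, 1 + ∑ j, G.routing i j * h j ≤ h i)
    (hfin : Summable fun x => μ 0 x * weight h x) {s t : ℝ} (hs : 0 ≤ s) (hst : s ≤ t) :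
    Real.log (envelope a (G.arrivals lam μ) t) + mean (μ t) (weight h) ≤
      Real.log (envelope a (G.arrivals lam μ) s) + mean (μ s) (weight h) +
        ∫ u in s..t, ((Fintype.card J + c) * ε - a * (1 - (envelope a (G.arrivals lam μ) u)⁻¹)) := by
  have hV0 : ∀ u, 0 ≤ u → 0 ≤ G.arrivals lam μ u := fun u hu => arrivals_nonneg hl hμ hu
  have hint : ∀ s t, 0 ≤ s → s ≤ t → IntervalIntegrable (G.arrivals lam μ)
      MeasureTheory.volume s t := fun s t hs hst => intervalIntegrable_arrivals hγ hl hμ hs hst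
  have hc0 : 0 ≤ c := hc ▸ Finset.sum_nonneg fun j _ => zero_le_one.trans (h1 j)
  have hhc (j : J) : h j ≤ c := hc ▸ Finset.single_le_sum
    (fun j _ => zero_le_one.trans (h1 j)) (Finset.mem_univ j)
  have hfs := (mean_weight_le hγ hl hμ h1 hc0 hhc hP le_rfl hs hfin).1
  have hM := (mean_weight_le hγ hl hμ h1 hc0 hhc hP hs hst hfs).2
  have hlog := log_envelope_sub hV0 hint ha hs hst
  have hU := intervalIntegrable_mean hγ hl hμ (abs_service_le hγ) hs hst
  have hR := intervalIntegrable_envelope_inv hV0 hint ha hs hst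
  have hV := intervalIntegral.integral_mono_on hst (hint s t hs hst)
    ((intervalIntegrable_const (c := Fintype.card J * ε)).add hU)
    fun u hu => arrivals_le_service hγ hl hμ (hs.trans hu.1)
  rw [intervalIntegral.integral_add intervalIntegrable_const hU,
    intervalIntegral.integral_const, smul_eq_mul] at hV
  rw [intervalIntegral.integral_sub intervalIntegrable_const hU,
    intervalIntegral.integral_const, smul_eq_mul, hc] at hM
  rw [intervalIntegral.integral_sub intervalIntegrable_const hR,
    intervalIntegral.integral_const, smul_eq_mul]
  linarith

end MeanField

theorem lemma4 {J : Type*} [Fintype J] [DecidableEq J] (G : MeanField.Network J) :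
    ∃ C : ℝ, 0 < C ∧ ∀ ε : ℝ, 0 < ε →
      ∀ μ₀ ∈ MeanField.probMeasures J, MeanField.FiniteWeight μ₀ →
        ∃ T : ℝ, 0 ≤ T ∧
          ∀ lam : J → ℝ → ℝ, MeanField.IsExternalInflow lam ε →
            ∀ μ : ℝ → List J → ℝ, G.IsNLMP lam μ → μ 0 = μ₀ →
              ∀ t : ℝ, T < t → MeanField.nonemptyFraction (μ t) < C * ε := by
  open MeanField in
  obtain ⟨γm, γ, hγm0, hγmγ, hrate⟩ := G.rate_bounds
  obtain ⟨h, h1, hP⟩ := G.exists_weight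
  have hγ (x : List J) : G.service x ≤ γ := by
    by_cases hx : x = []
    · rw [hx, G.service_nil]; linarith
    · exact (hrate x hx).2
  obtain ⟨a, rfl⟩ : ∃ a, γm = 2 * a := ⟨γm / 2, by ring⟩
  have ha : 0 < a := by linarith
  have hγm (x : List J) (hx : x ≠ []) : 2 * a ≤ G.service x := (hrate x hx).1
  obtain ⟨c, hc⟩ : ∃ c, ∑ j, h j = c := ⟨_, rfl⟩
  have hc0 : 0 ≤ c := hc ▸ Finset.sum_nonneg fun j _ => zero_le_one.trans (h1 j)
  have hhc (j : J) : h j ≤ c := hc ▸ Finset.single_le_sum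
    (fun j _ => zero_le_one.trans (h1 j)) (Finset.mem_univ j)
  set C₀ : ℝ := Fintype.card J + c + 1 with hC₀
  have hC₀pos : 0 < C₀ := by positivity
  set C₁ : ℝ := 4 * C₀ / a with hC₁
  have hC₁pos : 0 < C₁ := by positivity
  have haC : a * C₁ = 4 * C₀ := by rw [hC₁]; field_simp
  refine ⟨(1 + c) * C₁ + c + 1, by positivity, fun ε hε μ₀ hμ₀ hfin => ?_⟩
  by_cases hlarge : 1 < C₁ * ε
  · -- The bound exceeds the trivial bound `1`.
    refine ⟨0, le_rfl, fun lam _ μ hμ _ t ht => ?_⟩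
    refine (nonemptyFraction_le_one (hμ.mem_probMeasures t ht.le)).trans_lt (hlarge.trans_le ?_)
    gcongr
    nlinarith
  rw [not_lt] at hlarge
  have hlen : Summable fun x => μ₀ x * (x.length : ℝ) := hfin.congr fun x => mul_comm _ _
  have hw0 (x : List J) : 0 ≤ weight h x := (Nat.cast_nonneg _).trans (length_le_weight h1 x)
  have hwt : Summable fun x => μ₀ x * weight h x := by
    refine Summable.of_nonneg_of_le (fun x => mul_nonneg (hμ₀.1 x) (hw0 x)) (fun x => ?_)
      (hlen.mul_left c)
    have := mul_le_mul_of_nonneg_left (weight_le_length hhc x) (hμ₀.1 x)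
    linarith
  set M := mean μ₀ (weight h) with hM
  have hM0 : 0 ≤ M := mean_nonneg hμ₀ hw0
  obtain ⟨T₁, hT₁0, hT₁⟩ : ∃ T₁ : ℝ, 0 ≤ T₁ ∧ ∀ t, T₁ ≤ t → (mean μ₀ fun x => min
      (2 ^ x.length * Real.exp (M + a / 4 * t - a * t)) (x.length + (M + a / 4 * t))) < ε := by
    obtain ⟨T₁, h⟩ := Filter.eventually_atTop.1
      ((tendsto_mean_min_zero hμ₀ hlen ha hM0).eventually (gt_mem_nhds hε))
    exact ⟨max T₁ 0, le_max_right _ _, fun t ht => h t ((le_max_left _ _).trans ht)⟩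
  refine ⟨2 * T₁ + M / (C₀ * ε), by positivity, fun lam hl μ hμ h0 t ht => ?_⟩
  set V := G.arrivals lam μ with hV
  have hV0 : ∀ u, 0 ≤ u → 0 ≤ V u := fun u hu => arrivals_nonneg hl hμ hu
  have hint : ∀ s t, 0 ≤ s → s ≤ t → IntervalIntegrable V MeasureTheory.volume s t :=
    fun s t hs hst => intervalIntegrable_arrivals hγ hl hμ hs hst
  set R := envelope a V with hR
  have hR1 (u : ℝ) (hu : 0 ≤ u) : 1 ≤ R u := one_le_envelope hV0 hint ha hu
  have hp (u : ℝ) (hu : 0 ≤ u) := hμ.mem_probMeasures u hu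
  have hfin' (u : ℝ) (hu : 0 ≤ u) := mean_weight_le hγ hl hμ h1 hc0 hhc hP le_rfl hu
    (by rw [h0]; exact hwt)
  set Λ : ℝ → ℝ := fun u => Real.log (R u) + mean (μ u) (weight h) with hΛ
  have hΛle (s u : ℝ) (hs : 0 ≤ s) (hsu : s ≤ u) : Λ u ≤ Λ s +
      ∫ z in s..u, ((Fintype.card J + c) * ε - a * (1 - (R z)⁻¹)) :=
    lyapunov_le hγ ha hl hμ h1 hc hP (by rw [h0]; exact hwt) hs hsu
  have hLint (s u : ℝ) (hs : 0 ≤ s) (hsu : s ≤ u) : IntervalIntegrable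
      (fun z => (Fintype.card J + c) * ε - a * (1 - (R z)⁻¹)) MeasureTheory.volume s u :=
    intervalIntegrable_const.sub (intervalIntegrable_envelope_inv hV0 hint ha hs hsu)
  have hαΛ (u : ℝ) (hu : 0 ≤ u) : nonemptyFraction (μ u) ≤ Λ u := by
    have h2 := nonemptyFraction_le_mean (hp u hu) (fun x hx => ?_) (hw0 []) (hfin' u hu).1
    · linarith [Real.log_nonneg (hR1 u hu)]
    · refine le_trans ?_ (length_le_weight h1 x)
      exact_mod_cast List.length_pos_iff.2 hx
  have hΛ0 (u : ℝ) (hu : 0 ≤ u) : 0 ≤ Λ u :=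
    add_nonneg (Real.log_nonneg (hR1 u hu)) (mean_nonneg (hp u hu) hw0)
  -- The mean number of arrivals is sublinear up to a small slope.
  have hcum (u : ℝ) (hu : 0 ≤ u) : cumulative V u ≤ M + a / 4 * u := by
    have hU := intervalIntegrable_mean hγ hl hμ (abs_service_le hγ) le_rfl hu
    have h2 := intervalIntegral.integral_mono_on hu (hint 0 u le_rfl hu)
      ((intervalIntegrable_const (c := Fintype.card J * ε)).add hU)
      fun z hz => arrivals_le_service hγ hl hμ hz.1
    have h3 := (hfin' u hu).2
    have h4 : 0 ≤ mean (μ u) (weight h) := mean_nonneg (hp u hu) hw0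
    rw [intervalIntegral.integral_add intervalIntegrable_const hU,
      intervalIntegral.integral_const, smul_eq_mul] at h2
    rw [intervalIntegral.integral_sub intervalIntegrable_const hU,
      intervalIntegral.integral_const, smul_eq_mul, hc, h0, ← hM] at h3
    have h5 : (Fintype.card J + c) * ε ≤ a / 4 := by nlinarith
    have h6 := mul_le_mul_of_nonneg_left h5 hu
    change ∫ z in (0 : ℝ)..u, V z ≤ _
    linarith
  have hlength (u : ℝ) (hu : T₁ ≤ u) :
      mean (μ u) (fun x => (x.length : ℝ)) ≤ R u - 1 + ε := by
    have hu0 := hT₁0.trans hu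
    have hcu := hcum u hu0
    have hcu0 : 0 ≤ cumulative V u := by
      simpa [cumulative] using cumulative_mono hV0 hint le_rfl hu0
    refine (mean_length_le_envelope hγ ha hγm hl hμ (by rw [h0]; exact hlen) hu0).trans ?_
    refine add_le_add_right (le_trans ?_ (hT₁ u hu).le) _
    have hsum (w E : ℝ) (hw : 0 ≤ w) (hE : 0 ≤ E) :
        Summable fun x => μ₀ x * min (2 ^ x.length * E) (x.length + w) := by
      refine Summable.of_nonneg_of_le (fun x => mul_nonneg (hμ₀.1 x)
        (le_min (by positivity) (by positivity))) (fun x => mul_le_mul_of_nonneg_left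
        (min_le_right _ _) (hμ₀.1 x)) ((hlen.add (hμ₀.2.summable.mul_right w)).congr
        fun x => by ring)
    rw [h0]
    refine mean_mono hμ₀ (hsum _ _ hcu0 (Real.exp_pos _).le)
      (hsum _ _ (hcu0.trans hcu) (Real.exp_pos _).le) fun x => ?_
    gcongr
  have hweight (u : ℝ) (hu : T₁ ≤ u) : mean (μ u) (weight h) ≤ c * (R u - 1 + ε) := by
    have hu0 := hT₁0.trans hu
    have hs : Summable fun x => μ u x * (x.length : ℝ) :=
      Summable.of_nonneg_of_le (fun x => mul_nonneg ((hp u hu0).1 x) (Nat.cast_nonneg _))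
        (fun x => mul_le_mul_of_nonneg_left (length_le_weight h1 x) ((hp u hu0).1 x))
        (hfin' u hu0).1
    refine le_trans ?_ (mul_le_mul_of_nonneg_left (hlength u hu) hc0)
    rw [← mean_mul_left]
    exact mean_mono (hp u hu0) (hfin' u hu0).1 ((hs.mul_left c).congr fun x => by ring)
      (weight_le_length hhc)
  -- Above the threshold, the relaxation of the envelope outweighs the external arrivals.
  have hdecr (u : ℝ) (hu : 1 + C₁ * ε < R u) :
      (Fintype.card J + c) * ε - a * (1 - (R u)⁻¹) ≤ -(C₀ * ε) := by
    have hCε : 0 < C₁ * ε := by positivity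
    have h2 : (R u)⁻¹ ≤ (1 + C₁ * ε)⁻¹ := inv_anti₀ (by linarith) hu.le
    have h3 : (1 + C₁ * ε)⁻¹ ≤ 1 - C₁ * ε / 2 := by
      rw [inv_le_iff_one_le_mul₀ (by linarith)]
      nlinarith
    have h4 := mul_le_mul_of_nonneg_left (h2.trans h3) ha.le
    have h5 : a * (C₁ * ε / 2) = 2 * (C₀ * ε) := by
      rw [mul_div_assoc', ← mul_assoc, haC]; ring
    have h6 : (Fintype.card J + c) * ε ≤ C₀ * ε := by rw [hC₀]; nlinarith
    linarith
  have hTt : T₁ ≤ t := by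
    have : 0 ≤ M / (C₀ * ε) := by positivity
    linarith
  have ht0 : 0 ≤ t := hT₁0.trans hTt
  have hRc : ContinuousOn R (Set.Icc T₁ t) :=
    (continuousOn_envelope hint a).mono fun u hu => hT₁0.trans hu.1
  set S : Set ℝ := Set.Icc T₁ t ∩ R ⁻¹' Set.Iic (1 + C₁ * ε) with hS
  have hScl : IsCompact S := isCompact_Icc.of_isClosed_subset
    (hRc.preimage_isClosed_of_isClosed isClosed_Icc isClosed_Iic) Set.inter_subset_left
  rcases S.eq_empty_or_nonempty with hSe | hSn
  · -- The Lyapunov function cannot decrease linearly during all of `[T₁, t]`.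
    exfalso
    have h2 := hΛle 0 T₁ le_rfl hT₁0
    have h3 := intervalIntegral.integral_mono_on hT₁0 (hLint 0 T₁ le_rfl hT₁0)
      (intervalIntegrable_const (c := C₀ * ε)) fun u hu => by
        have h4 : (R u)⁻¹ ≤ 1 := inv_le_one_of_one_le₀ (hR1 u hu.1)
        have h5 := mul_nonneg ha.le (sub_nonneg.2 h4)
        have h6 : (Fintype.card J + c) * ε ≤ C₀ * ε := by rw [hC₀]; nlinarith
        exact (sub_le_self _ h5).trans h6
    have h4 := hΛle T₁ t hT₁0 hTt
    have h5 := intervalIntegral.integral_mono_on hTt (hLint T₁ t hT₁0 hTt)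
      (intervalIntegrable_const (c := -(C₀ * ε))) fun u hu => hdecr u (by
        by_contra hlt
        exact (hSe ▸ (⟨hu, not_lt.1 hlt⟩ : u ∈ S) : u ∈ (∅ : Set ℝ)))
    rw [intervalIntegral.integral_const, smul_eq_mul] at h3 h5
    have h6 : Λ 0 = M := by simp [hΛ, hR, envelope_zero, h0, hM]
    have h7 := hΛ0 t ht0
    have h8 : M < (t - 2 * T₁) * (C₀ * ε) := by
      rw [← div_lt_iff₀ (by positivity)]; linarith
    nlinarith
  · -- After the last time below the threshold, the Lyapunov function does not increase.
    obtain ⟨s, ⟨hsI, hsR⟩, hsmax⟩ := hScl.exists_isGreatest hSn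
    have hs0 := hT₁0.trans hsI.1
    have h2 := hΛle s t hs0 hsI.2
    have h3 := intervalIntegral.integral_mono_on_of_le_Ioo hsI.2 (hLint s t hs0 hsI.2)
      (intervalIntegrable_const (c := (0 : ℝ))) fun u hu => (hdecr u (by
        by_contra hlt
        exact hu.1.not_ge (hsmax ⟨⟨hsI.1.trans hu.1.le, hu.2.le⟩, not_lt.1 hlt⟩))).trans
        (neg_nonpos.2 (by positivity))
    rw [intervalIntegral.integral_const, smul_zero] at h3
    have h4 : Real.log (R s) ≤ R s - 1 :=
      Real.log_le_sub_one_of_pos (by linarith [hR1 s hs0])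
    have h5 := hweight s hsI.1
    have h6 : R s ≤ 1 + C₁ * ε := hsR
    have h7 : Λ s ≤ C₁ * ε + c * (C₁ * ε + ε) := by
      have := mul_le_mul_of_nonneg_left (show R s - 1 + ε ≤ C₁ * ε + ε by linarith) hc0
      change Real.log (R s) + mean (μ s) (weight h) ≤ _
      linarith
    have h8 := hαΛ t ht0
    linarith
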